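/- **Setting.** Finitely many processes communicate by asynchronous message passing, without failures. In a step, a process receives a message, or a client request, or nothing; then (possibly nondeterministically) it changes its local state, sends messages, and answers clients. In a fair execution, every process takes steps for ever and every message is eventually received; no bound on delays or speeds is assumed. Every object $x$ is held by a set $\mathrm{replicas}(x)$ of processes. Infinitely many transaction identifiers are available. The client of a transaction $T_i$ issues its requests one at a time (read $x$; write $x$; commit), all of them to one process, the coordinator of $T_i$, so that the objects accessed by $T_i$ are not known in advance; a request is answered by success (a read returns a version) or by an abort. Each object is read at most once and written at most once by $T_i$, and is read before it is written. $r_i(x_j)$ means that $T_i$ reads the version $x_j$ of $x$ written by $T_j$, $w_i(x_i)$ that $T_i$ writes $x$, $c_i$ that $T_i$ commits. An initial transaction $T_0$ writes version $x_0$ of every object $x$ and commits before everything else. An execution $\rho$ produces a history $h=\mathfrak F(\rho)$: the operations completed in $\rho$ together with those of $T_0$, with a strict partial order $<_h$ such that $o<_h o'$ whenever $o$ is answered before $o'$ is requested, $w_j(x_j)<_h r_i(x_j)$ for every read $r_i(x_j)$ in $h$, and any two writes of the same object are ordered (by the version order $x_i\ll_h x_j \iff w_i(x_i)<_h w_j(x_j)$).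 The system implements a criterion if all its histories satisfy it. * **GPR** (genuine partial replication): only processes that replicate an object accessed by $T_i$ make steps to execute $T_i$ (the coordinator of $T_i$, which receives the requests of $T_i$, is also allowed to make such steps), and every step, other than an idle step without sends and answers, is made to execute some transaction. Only executions in which all started transactions have terminated need to satisfy this. * **OFU** (obstruction-free updates): in every fair execution, the requests of an update transaction $T_i$ are eventually answered (so $T_i$ terminates), and if no concurrent transaction writes an object that $T_i$ writes, then $T_i$ is not aborted (so it commits). * **WFQ** (wait-free queries): in every fair execution, the requests of a read-only transaction are eventually answered, never by an abort (so it commits), whatever the other transactions do. * **SCONS-b**: for all committed $T_i,T_j,T_k,T_l$ with $k\ne j$, if $r_i(x_j),r_i(y_l),w_k(x_k)\in h$ and $c_k<_h c_l$, then $c_k<_h c_j$. * **WCF**: if two distinct committed transactions write a common object, one of them depends on the other, where "depends" is the transitive closure of "$T_i$ reads a version written by $T_j$". * **ACA**: if $r_i(x_j)\in h$ and $i\neq j$, then $c_j<_h r_i(x_j)$. * **Positive-freshness acceptance**: let $h=\mathfrak F(\rho)$ with $T_i$ not terminated, the next operation of $T_i$ being a read of $x$, and let $x_j$ be the latest version of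 $x$ committed before the first operation of $T_i$. If $h.r_i(x_j)$ satisfies snapshot isolation SI and no transaction concurrent with $T_i$ write-conflicts with $T_i$, then there is an extension of $\rho$, in which that read is the only new request of $T_i$, such that $T_i$ reads $x_j$ or a later version (in the sense of $\ll_h$). Here $h$ satisfies SI if $<_h$ extends to a strict partial order $<$ on the operations and one snapshot point $s_i$ per transaction, with $s_i$ before all operations of $T_i$, such that: (read rule) for all $r_i(x_j)$, $w_k(x_k)$, $c_k$ in $h$ with $j\ne i$, $k\neq j$: $c_j\in h$, $c_j<s_i$, and $c_k<c_j$ or $s_i<c_k$; (write rule) if $T_i\neq T_j$ are committed and write a common object, then $c_i<s_j$ or $c_j<s_i$. **Theorem.** Consider an asynchronous failure-free system as above that satisfies GPR, OFU and WFQ, in which some two objects have non-empty, disjoint replica sets. Suppose that either all its histories satisfy WCF (for instance because they all satisfy SI), or all its histories satisfy ACA and the system has positive-freshness acceptance. Then the system does not implement SCONS-b: it has an execution whose history violates SCONS-b. -/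

import Mathlib

namespace PartialReplication

/-! ## Operations and histories

A client identifier is an element of `Tx`. A transaction identifier of a history is an element of
`Option Tx`: `none` is the initial transaction `T₀`, which writes the initial version of every
object, and `some i` is the transaction `Tᵢ`. Version `j` of an object is the one written by `Tⱼ`. -/

/-- `read i x j` is `rᵢ(xⱼ)`, `write i x` is `wᵢ(xᵢ)`, `commit i` is `cᵢ`, `abort i` is `aᵢ`. -/
inductive Operation (Obj Tx : Type*)
  | read (i : Option Tx) (x : Obj) (j : Option Tx)
  | write (i : Option Tx) (x : Obj)
  | commit (i : Option Tx)
  | abort (i : Option Tx)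

/-- The transaction to which an operation belongs. -/
def Operation.tx {Obj Tx : Type*} : Operation Obj Tx → Option Tx
  | .read i _ _ => i
  | .write i _ => i
  | .commit i => i
  | .abort i => i

/-- A set of operations with a relation `lt` (the order `<_h`). -/
structure History (Obj Tx : Type*) where
  ops : Set (Operation Obj Tx)
  lt : Operation Obj Tx → Operation Obj Tx → Prop

namespace History

variable {Obj Tx : Type*}

/-- The axioms of histories: `<_h` is a strict partial order on the operations, every read `rᵢ(xⱼ)`
is preceded by the write `wⱼ(xⱼ)`, and any two writes of the same object are ordered.
(That `<_h` contains the order of each transaction is part of `Protocol.IsRefinement` below.) -/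
structure IsHistory (h : History Obj Tx) : Prop where
  mem_of_lt : ∀ a b, h.lt a b → a ∈ h.ops ∧ b ∈ h.ops
  irrefl : ∀ a, ¬ h.lt a a
  trans : ∀ a b c, h.lt a b → h.lt b c → h.lt a c
  reads_from : ∀ i x j, Operation.read i x j ∈ h.ops →
    h.lt (Operation.write j x) (Operation.read i x j)
  writes_ordered : ∀ i j x, i ≠ j → Operation.write i x ∈ h.ops → Operation.write j x ∈ h.ops →
    h.lt (Operation.write i x) (Operation.write j x) ∨
      h.lt (Operation.write j x) (Operation.write i x)

/-- The second condition of strictly consistent snapshots: for all committed transactions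
`Tᵢ, Tⱼ, T_k, T_l` with `k ≠ j`, if `rᵢ(xⱼ), rᵢ(y_l), w_k(x_k) ∈ h` and `c_k <_h c_l`,
then `c_k <_h cⱼ`. -/
def SCONSb (h : History Obj Tx) : Prop :=
  ∀ (i j k l : Option Tx) (x y : Obj), k ≠ j →
    Operation.commit i ∈ h.ops → Operation.commit j ∈ h.ops →
    Operation.commit k ∈ h.ops → Operation.commit l ∈ h.ops →
    Operation.read i x j ∈ h.ops → Operation.read i y l ∈ h.ops → Operation.write k x ∈ h.ops →
    h.lt (Operation.commit k) (Operation.commit l) →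
    h.lt (Operation.commit k) (Operation.commit j)

/-- `Tᵢ` depends on `Tⱼ`: the transitive closure of "`Tᵢ` reads a version written by `Tⱼ`". -/
def Depends (h : History Obj Tx) : Option Tx → Option Tx → Prop :=
  Relation.TransGen fun i j => ∃ x, Operation.read i x j ∈ h.ops

/-- Write-conflict freedom: two independent transactions that write the same object
never both commit. -/
def WCF (h : History Obj Tx) : Prop :=
  ∀ (i j : Option Tx) (x : Obj), i ≠ j →
    Operation.commit i ∈ h.ops → Operation.commit j ∈ h.ops →
    Operation.write i x ∈ h.ops → Operation.write j x ∈ h.ops →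
    h.Depends i j ∨ h.Depends j i

/-- Absence of cascading aborts: transactions read committed versions only. -/
def ACA (h : History Obj Tx) : Prop :=
  ∀ (i j : Option Tx) (x : Obj), i ≠ j → Operation.read i x j ∈ h.ops →
    h.lt (Operation.commit j) (Operation.read i x j)

/-- The history `h.o`: operation `o` is appended after all operations of `h`. -/
def append (h : History Obj Tx) (o : Operation Obj Tx) : History Obj Tx where
  ops := insert o h.ops
  lt a b := h.lt a b ∨ (a ∈ h.ops ∧ b = o)

/-- Snapshot isolation. The points of the extended history `h_s` are the operations of `h`
(`Sum.inl o`) and one snapshot point `sᵢ` per transaction (`Sum.inr i`). -/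
def SI (h : History Obj Tx) : Prop :=
  ∃ lt : (Operation Obj Tx ⊕ Option Tx) → (Operation Obj Tx ⊕ Option Tx) → Prop,
    (∀ a, ¬ lt a a) ∧ (∀ a b c, lt a b → lt b c → lt a c) ∧
    -- `h_s` extends `h`, and the snapshot point of `Tᵢ` precedes every operation of `Tᵢ`
    (∀ a b, h.lt a b → lt (Sum.inl a) (Sum.inl b)) ∧
    (∀ o ∈ h.ops, lt (Sum.inr o.tx) (Sum.inl o)) ∧
    -- read rule
    (∀ (i j k : Option Tx) (x : Obj), j ≠ i → k ≠ j → Operation.read i x j ∈ h.ops →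
      Operation.write k x ∈ h.ops → Operation.commit k ∈ h.ops →
      Operation.commit j ∈ h.ops ∧ lt (Sum.inl (Operation.commit j)) (Sum.inr i) ∧
      (lt (Sum.inl (Operation.commit k)) (Sum.inl (Operation.commit j)) ∨
        lt (Sum.inr i) (Sum.inl (Operation.commit k)))) ∧
    -- write rule
    (∀ (i j : Option Tx) (x : Obj), i ≠ j → Operation.commit i ∈ h.ops →
      Operation.commit j ∈ h.ops → Operation.write i x ∈ h.ops → Operation.write j x ∈ h.ops →
      lt (Sum.inl (Operation.commit i)) (Sum.inr j) ∨
        lt (Sum.inl (Operation.commit j)) (Sum.inr i))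

end History

/-! ## Asynchronous message-passing systems -/

/-- The requests of a client on behalf of its transaction, issued one at a time: a system does not
know in advance which objects a transaction accesses. -/
inductive Request (Obj Val : Type*)
  | read (x : Obj)
  | write (x : Obj) (v : Val)
  | commit

/-- The answers to requests. `ok j` reports success; `j` is the version returned by a read
(and carries no information for other requests). `abort` terminates the transaction. -/
inductive Reply (Tx : Type*)
  | ok (j : Option Tx)
  | abort

/-- What a process is given in a step: nothing, a message, or a request of the client of `Tᵢ`. -/
inductive Input (Obj Tx Val Msg : Type*)
  | idle
  | receive (m : Msg)
  | request (i : Tx) (r : Request Obj Val)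

/-- What a process does in a step: it moves to a new local state, sends messages, and answers
clients. -/
structure Outcome (P Tx State Msg : Type*) where
  state : State
  sends : Multiset (P × Msg)
  replies : Tx → Option (Reply Tx)

/-- A (possibly nondeterministic) protocol run by the processes `P`. -/
structure Protocol (P Obj Tx Val State Msg : Type*) where
  init : P → State
  next : P → State → Input Obj Tx Val Msg → Set (Outcome P Tx State Msg)
  next_nonempty : ∀ p q e, (next p q e).Nonempty

/-- A step of process `proc`. -/
structure Step (P Obj Tx Val State Msg : Type*) where
  proc : P
  input : Input Obj Tx Val Msg
  outcome : Outcome P Tx State Msg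

/-- A step in which the process receives nothing, sends nothing and answers nobody. -/
def Step.Silent {P Obj Tx Val State Msg : Type*} (s : Step P Obj Tx Val State Msg) : Prop :=
  s.input = Input.idle ∧ s.outcome.sends = 0 ∧ ∀ i, s.outcome.replies i = none

/-- A finite or infinite sequence of steps, `none` being "no such step". -/
abbrev Trace (P Obj Tx Val State Msg : Type*) := ℕ → Option (Step P Obj Tx Val State Msg)

/-- A finite sequence of steps as a trace. -/
def toTrace {P Obj Tx Val State Msg : Type*} (ρ : List (Step P Obj Tx Val State Msg)) :
    Trace P Obj Tx Val State Msg := fun n => ρ[n]?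

/-- An infinite sequence of steps as a trace. -/
def ofSeq {P Obj Tx Val State Msg : Type*} (σ : ℕ → Step P Obj Tx Val State Msg) :
    Trace P Obj Tx Val State Msg := fun n => some (σ n)

/-- The operation that is completed when request `r` of `Tᵢ` is answered by `a`. -/
def opOf {Obj Tx Val : Type*} (i : Tx) : Request Obj Val → Reply Tx → Operation Obj Tx
  | .read x, .ok j => .read (some i) x j
  | .write x _, .ok _ => .write (some i) x
  | .commit, .ok _ => .commit (some i)
  | _, .abort => .abort (some i)

namespace Trace

variable {P Obj Tx Val State Msg : Type*} (τ : Trace P Obj Tx Val State Msg)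

/-- The client of `Tᵢ` issues request `r` to process `p` in step `m`. -/
def RequestAt (i : Tx) (r : Request Obj Val) (p : P) (m : ℕ) : Prop :=
  ∃ s, τ m = some s ∧ s.proc = p ∧ s.input = Input.request i r

/-- The client of `Tᵢ` is given the reply `a` in step `n`. -/
def ReplyAt (i : Tx) (a : Reply Tx) (n : ℕ) : Prop :=
  ∃ s, τ n = some s ∧ s.outcome.replies i = some a

/-- Request `r` of `Tᵢ`, issued in step `m`, is answered by `a` in step `n` (possibly `n = m`). -/
def Answered (i : Tx) (r : Request Obj Val) (a : Reply Tx) (m n : ℕ) : Prop :=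
  (∃ p, τ.RequestAt i r p m) ∧ τ.ReplyAt i a n ∧ m ≤ n ∧
    ∀ k, m ≤ k → k < n → ∀ a', ¬ τ.ReplyAt i a' k

/-- `Tᵢ` has a request without an answer. -/
def Waiting (i : Tx) : Prop :=
  ∃ r p m, τ.RequestAt i r p m ∧ ∀ k, m ≤ k → ∀ a, ¬ τ.ReplyAt i a k

/-- `Tᵢ` commits in step `n`. -/
def CommittedAt (i : Tx) (n : ℕ) : Prop :=
  ∃ j m, τ.Answered i Request.commit (Reply.ok j) m n

/-- `Tᵢ` commits or aborts in step `n`. -/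
def TerminatedAt (i : Tx) (n : ℕ) : Prop :=
  τ.CommittedAt i n ∨ ∃ r m, τ.Answered i r Reply.abort m n

def Started (i : Tx) : Prop := ∃ r p m, τ.RequestAt i r p m

def Terminated (i : Tx) : Prop := ∃ n, τ.TerminatedAt i n

/-- The coordinator of `Tᵢ` is the process to which its client issues its requests. -/
def Coordinates (p : P) (i : Tx) : Prop := ∃ r m, τ.RequestAt i r p m

def Reads (i : Tx) (x : Obj) : Prop := ∃ p m, τ.RequestAt i (Request.read x) p m

def Writes (i : Tx) (x : Obj) : Prop := ∃ v p m, τ.RequestAt i (Request.write x v) p m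

/-- The initial transaction, together with the operations that are completed in the trace. -/
def ops : Set (Operation Obj Tx) :=
  {o | (∃ x, o = Operation.write none x) ∨ o = Operation.commit none ∨
    ∃ i r a m n, τ.Answered i r a m n ∧ o = opOf i r a}

/-- Real-time precedence of operations: the answer to the first comes before the request of the
second. The initial transaction precedes everything else. -/
inductive RealTime : Operation Obj Tx → Operation Obj Tx → Prop
  | init (x : Obj) : RealTime (Operation.write none x) (Operation.commit none)
  | init_write (x : Obj) (i : Tx) (r : Request Obj Val) (a : Reply Tx) (m n : ℕ) :
      τ.Answered i r a m n → RealTime (Operation.write none x) (opOf i r a)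
  | init_commit (i : Tx) (r : Request Obj Val) (a : Reply Tx) (m n : ℕ) :
      τ.Answered i r a m n → RealTime (Operation.commit none) (opOf i r a)
  | before (i i' : Tx) (r r' : Request Obj Val) (a a' : Reply Tx) (m n m' n' : ℕ) :
      τ.Answered i r a m n → τ.Answered i' r' a' m' n' → n < m' →
      RealTime (opOf i r a) (opOf i' r' a')

/-- `Tᵢ` terminates before the first request of `Tⱼ`. -/
def Precedes (i j : Tx) : Prop :=
  ∃ n, τ.TerminatedAt i n ∧ ∀ r p m, τ.RequestAt j r p m → n < m

/-- No transaction concurrent with `Tᵢ` writes an object that `Tᵢ` writes. -/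
def NoConcurrentWriteConflict (i : Tx) : Prop :=
  ∀ j x, j ≠ i → τ.Writes i x → τ.Writes j x → τ.Precedes i j ∨ τ.Precedes j i

/-- The client of `Tᵢ` may issue request `r` to process `p` after the steps of `τ`: it always talks
to the same process, waits for answers, stops after termination, reads and writes every object at
most once, and has read what it writes. -/
def Allowed (i : Tx) (p : P) (r : Request Obj Val) : Prop :=
  (∀ p', τ.Coordinates p' i → p' = p) ∧ ¬ τ.Waiting i ∧ ¬ τ.Terminated i ∧
  match r with
  | .read x => ¬ τ.Reads i x
  | .write x _ => τ.Reads i x ∧ ¬ τ.Writes i x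
  | .commit => True

end Trace

/-- The local states of the processes and the messages in transit, with their destinations. -/
structure Config (P State Msg : Type*) where
  state : P → State
  buffer : Multiset (P × Msg)

namespace Protocol

variable {P Obj Tx Val State Msg : Type*} (S : Protocol P Obj Tx Val State Msg)

/-- Step `s` leads from configuration `c` to configuration `c'`. -/
def StepRel (c : Config P State Msg) (s : Step P Obj Tx Val State Msg)
    (c' : Config P State Msg) : Prop :=
  s.outcome ∈ S.next s.proc (c.state s.proc) s.input ∧
  c'.state s.proc = s.outcome.state ∧ (∀ p, p ≠ s.proc → c'.state p = c.state p) ∧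
  match s.input with
  | .receive m => ∃ rest, c.buffer = (s.proc, m) ::ₘ rest ∧ c'.buffer = rest + s.outcome.sends
  | _ => c'.buffer = c.buffer + s.outcome.sends

/-- The finite failure-free executions, with the configurations they reach. Nothing is assumed on
the relative speeds of processes or on message delays. -/
inductive Reaches : List (Step P Obj Tx Val State Msg) → Config P State Msg → Prop
  | nil : Reaches [] ⟨S.init, 0⟩
  | snoc (ρ : List (Step P Obj Tx Val State Msg)) (c : Config P State Msg)
      (s : Step P Obj Tx Val State Msg) (c' : Config P State Msg) :
      Reaches ρ c → S.StepRel c s c' →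
      (∀ i r, s.input = Input.request i r → (toTrace ρ).Allowed i s.proc r) →
      Reaches (ρ ++ [s]) c'

def IsExecution (ρ : List (Step P Obj Tx Val State Msg)) : Prop := ∃ c, S.Reaches ρ c

/-- An infinite execution in which every process takes steps for ever and every message is
eventually received. -/
def IsFairExecution (σ : ℕ → Step P Obj Tx Val State Msg) : Prop :=
  (∀ n, S.IsExecution ((List.range n).map σ)) ∧
  (∀ p n, ∃ k, n ≤ k ∧ (σ k).proc = p ∧ ∀ i r, (σ k).input ≠ Input.request i r) ∧
  (∀ n c, S.Reaches ((List.range n).map σ) c → ∀ p m, (p, m) ∈ c.buffer →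
    ∃ k, n ≤ k ∧ (σ k).proc = p ∧ (σ k).input = Input.receive m)

/-- `F` maps every execution to a history that it produces: the operations are those completed in
the execution, and if the steps that implement one operation all precede the steps that implement
another one, then the operations are ordered in the same way. Operations whose steps
interleave may be ordered by `F` in any way, or not at all. -/
def IsRefinement (F : List (Step P Obj Tx Val State Msg) → History Obj Tx) : Prop :=
  ∀ ρ, S.IsExecution ρ → (F ρ).IsHistory ∧ (F ρ).ops = (toTrace ρ).ops ∧
    ∀ a b, (toTrace ρ).RealTime a b → (F ρ).lt a b

/-- All histories produced by the system satisfy the criterion `C`. -/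
def Implements (F : List (Step P Obj Tx Val State Msg) → History Obj Tx)
    (C : History Obj Tx → Prop) : Prop :=
  ∀ ρ, S.IsExecution ρ → C (F ρ)

/-- Genuine partial replication: in an execution of (terminated) transactions, every step can be
attributed to a transaction `Tᵢ` such that the process that makes it replicates an object accessed
by `Tᵢ`, or is the coordinator of `Tᵢ`. (Silent steps, with which processes just let time pass,
execute no transaction.) -/
def GPR (replicas : Obj → Set P) : Prop :=
  ∀ ρ, S.IsExecution ρ → (∀ i, (toTrace ρ).Started i → (toTrace ρ).Terminated i) →
    ∀ s ∈ ρ, ¬ s.Silent → ∃ i, (toTrace ρ).Started i ∧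
      ((∃ x, ((toTrace ρ).Reads i x ∨ (toTrace ρ).Writes i x) ∧ s.proc ∈ replicas x) ∨
        (toTrace ρ).Coordinates s.proc i)

/-- Obstruction-free updates: the requests of an update transaction are eventually answered (hence
it terminates), and without concurrent write-conflicting transaction it is not aborted (hence it
commits). -/
def OFU : Prop :=
  ∀ σ, S.IsFairExecution σ → ∀ i, (∃ x, (ofSeq σ).Writes i x) →
      (∀ r p m, (ofSeq σ).RequestAt i r p m → ∃ a n, (ofSeq σ).Answered i r a m n) ∧
      ((ofSeq σ).NoConcurrentWriteConflict i → ∀ r m n, ¬ (ofSeq σ).Answered i r Reply.abort m n)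

/-- Wait-free queries: whatever the other transactions do, the requests of a read-only transaction
are eventually answered, and never by an abort (hence it commits). -/
def WFQ : Prop :=
  ∀ σ, S.IsFairExecution σ → ∀ i, (¬ ∃ x, (ofSeq σ).Writes i x) →
      (∀ r p m, (ofSeq σ).RequestAt i r p m → ∃ a n, (ofSeq σ).Answered i r a m n) ∧
      ∀ r m n, ¬ (ofSeq σ).Answered i r Reply.abort m n

/-- `Tⱼ` (or the initial transaction) commits before the first request of `Tᵢ`. -/
def CommittedBefore (ρ : List (Step P Obj Tx Val State Msg)) (i : Tx) : Option Tx → Prop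
  | none => True
  | some j => ∃ n, (toTrace ρ).CommittedAt j n ∧
      ∀ r p m, (toTrace ρ).RequestAt i r p m → n < m

/-- Positive-freshness acceptance. Let `h` be the history of an execution `ρ` after which the next
operation of `Tᵢ` is a read of `x`, and `xⱼ` the latest version of `x` committed before the first
operation of `Tᵢ`. If `h.rᵢ(xⱼ)` is in SI and no concurrent transaction write-conflicts with `Tᵢ`,
then `ρ` can be extended so that `Tᵢ` reads at least version `xⱼ` of `x`. -/
def PositiveFreshness (F : List (Step P Obj Tx Val State Msg) → History Obj Tx) : Prop :=
  ∀ ρ, S.IsExecution ρ → ∀ (i : Tx) (p : P) (x : Obj) (j : Option Tx),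
    (toTrace ρ).Allowed i p (Request.read x : Request Obj Val) →
    (Operation.write j x ∈ (F ρ).ops ∧ CommittedBefore ρ i j ∧
      ∀ k, Operation.write k x ∈ (F ρ).ops → CommittedBefore ρ i k →
        ¬ (F ρ).lt (Operation.write j x) (Operation.write k x)) →
    ((F ρ).append (Operation.read (some i) x j)).SI →
    (toTrace ρ).NoConcurrentWriteConflict i →
    ∃ ρ', S.IsExecution (ρ ++ ρ') ∧
      (∀ s ∈ ρ', ∀ r, s.input = Input.request i r → r = Request.read x ∧ s.proc = p) ∧
      ∃ k, Operation.read (some i) x k ∈ (F (ρ ++ ρ')).ops ∧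
        (k = j ∨ (F (ρ ++ ρ')).lt (Operation.write j x) (Operation.write k x))

end Protocol

end PartialReplication

/-! Let `x` and `y` have disjoint replica sets. Two blocks of steps are built. In `α`, a transaction
`T_b` updates `y` and commits. In `β`, a transaction `T_a` reads `x`, necessarily the initial
version, and then `T_t` updates `x` and commits, while `T_a` remains open. By genuineness, only
replicas of `y` act in `α` and only replicas of `x` act in `β`, up to silent steps, which can be
deleted (`exists_update_block`, `exists_read_update_block`).

The blocks involve disjoint processes and disjoint clients, so `α ++ β` and `β ++ α` are both
executions (`Reaches.append_of_disjoint`), they end in the same configuration, and clients cannot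
tell them apart (`Log.clientEquiv_append_comm`). Hence they have the same continuations
(`Reaches.transfer`).

After `α ++ β`, transaction `T_b` lies entirely before `T_a`, and a continuation exists in which
`T_a` reads the version of `y` written by `T_b`, or a later one. Under WCF, `T_a` also writes `y`
and commits: one of `T_a` and `T_b` must depend on the other, and the only way is that `T_a` reads
from `T_b`. Under ACA with positive freshness, the history extended by that read is in SI
(`History.SI_append_read`), so acceptance supplies the continuation.

The same continuation is then run after `β ++ α`. There `T_t` commits before the writer of the
version of `y` that `T_a` reads, although `T_a` has read the initial version of `x`, which `T_t`
overwrites. SCONS-b would place the commit of `T_t` before that of the initial transaction, which is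
absurd (`IsRefinement.not_implements_SCONSb`).

Progress is used through `exists_call`: every finite execution has a fair extension without new
requests (`Reaches.exists_fair`), in which OFU or WFQ forces a positive answer, and the extension is
cut at that answer. -/

namespace PartialReplication

variable {P Obj Tx Val State Msg : Type*}

/-! ### What clients see of a trace -/

namespace Trace

variable {τ τ' : Trace P Obj Tx Val State Msg} {i : Tx} {r : Request Obj Val} {a : Reply Tx}
  {p : P} {m n : ℕ}

/-- Request `r` of `Tᵢ` is issued to `p` at some time. -/
def Requested (τ : Trace P Obj Tx Val State Msg) (i : Tx) (r : Request Obj Val) (p : P) : Prop :=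
  ∃ m, τ.RequestAt i r p m

/-- Request `r` of `Tᵢ` is issued and never answered. -/
def Pending (τ : Trace P Obj Tx Val State Msg) (i : Tx) (r : Request Obj Val) : Prop :=
  ∃ p m, τ.RequestAt i r p m ∧ ∀ k, m ≤ k → ∀ a, ¬ τ.ReplyAt i a k

/-- Request `r` of `Tᵢ` is answered by `a` at some time. -/
def Done (τ : Trace P Obj Tx Val State Msg) (i : Tx) (r : Request Obj Val) (a : Reply Tx) : Prop :=
  ∃ m n, τ.Answered i r a m n

/-- The first reply given to `Tᵢ` is `a`. -/
def FirstReply (τ : Trace P Obj Tx Val State Msg) (i : Tx) (a : Reply Tx) : Prop :=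
  ∃ n, τ.ReplyAt i a n ∧ ∀ k, k < n → ∀ a', ¬ τ.ReplyAt i a' k

theorem waiting_iff : τ.Waiting i ↔ ∃ r, τ.Pending i r := Iff.rfl

theorem terminated_iff :
    τ.Terminated i ↔ (∃ j, τ.Done i Request.commit (Reply.ok j)) ∨
      ∃ r, τ.Done i r Reply.abort := by
  constructor
  · rintro ⟨n, ⟨j, m, h⟩ | ⟨r, m, h⟩⟩
    · exact Or.inl ⟨j, m, n, h⟩
    · exact Or.inr ⟨r, m, n, h⟩
  · rintro (⟨j, m, n, h⟩ | ⟨r, m, n, h⟩)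
    · exact ⟨n, Or.inl ⟨j, m, h⟩⟩
    · exact ⟨n, Or.inr ⟨r, m, h⟩⟩

theorem requestAt_congr (h : τ m = τ' m) : τ.RequestAt i r p m ↔ τ'.RequestAt i r p m := by
  unfold RequestAt; rw [h]

theorem replyAt_congr (h : τ m = τ' m) : τ.ReplyAt i a m ↔ τ'.ReplyAt i a m := by
  unfold ReplyAt; rw [h]

theorem Answered.congr (h : ∀ k ≤ n, τ k = τ' k) (ha : τ.Answered i r a m n) :
    τ'.Answered i r a m n := by
  obtain ⟨⟨p, hp⟩, hr, hmn, hf⟩ := ha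
  exact ⟨⟨p, (requestAt_congr (h m hmn)).1 hp⟩, (replyAt_congr (h n le_rfl)).1 hr, hmn,
    fun k hk hkn a' h' => hf k hk hkn a' ((replyAt_congr (h k hkn.le)).2 h')⟩

theorem Answered.shift {d : ℕ} (h : ∀ k, τ (d + k) = τ' k) :
    τ.Answered i r a (d + m) (d + n) ↔ τ'.Answered i r a m n := by
  have hq : ∀ p k, τ.RequestAt i r p (d + k) ↔ τ'.RequestAt i r p k := by
    intro p k; unfold RequestAt; rw [h]
  have ha : ∀ a k, τ.ReplyAt i a (d + k) ↔ τ'.ReplyAt i a k := by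
    intro p k; unfold ReplyAt; rw [h]
  unfold Answered
  simp only [hq, ha, Nat.add_le_add_iff_left]
  refine and_congr_right fun _ => and_congr_right fun _ => and_congr_right fun _ => ?_
  constructor
  · intro hf k hk hkn a'
    rw [← ha]; exact hf _ (by omega) (by omega) a'
  · intro hf k hk hkn a'
    obtain ⟨k, rfl⟩ := Nat.exists_eq_add_of_le (show d ≤ k by omega)
    rw [ha]; exact hf _ (by omega) (by omega) a'

theorem ReplyAt.unique {a' : Reply Tx} (h : τ.ReplyAt i a n) (h' : τ.ReplyAt i a' n) :
    a = a' := by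
  obtain ⟨s, hs, hr⟩ := h
  obtain ⟨s', hs', hr'⟩ := h'
  rw [hs] at hs'; cases hs'
  rw [hr] at hr'; exact Option.some.inj hr'

theorem Answered.unique {r' : Request Obj Val} {a' : Reply Tx} {n' : ℕ}
    (h : τ.Answered i r a m n) (h' : τ.Answered i r' a' m n') : n = n' ∧ a = a' := by
  have hn : n = n' := by
    rcases lt_trichotomy n n' with hlt | he | hlt
    · exact absurd h.2.1 (h'.2.2.2 n h.2.2.1 hlt a)
    · exact he
    · exact absurd h'.2.1 (h.2.2.2 n' h'.2.2.1 hlt a')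
  subst hn
  exact ⟨rfl, h.2.1.unique h'.2.1⟩

end Trace

/-! ### Concatenation of traces, client equivalence and logs. -/

section Lists

variable {ρ ρ' ρ₁ ρ₂ : List (Step P Obj Tx Val State Msg)} {s : Step P Obj Tx Val State Msg}
  {i : Tx} {r : Request Obj Val} {a : Reply Tx} {p : P} {m n : ℕ}

theorem toTrace_append_of_lt (h : m < ρ₁.length) : toTrace (ρ₁ ++ ρ₂) m = toTrace ρ₁ m :=
  List.getElem?_append_left h

theorem toTrace_append_add (k : ℕ) : toTrace (ρ₁ ++ ρ₂) (ρ₁.length + k) = toTrace ρ₂ k := by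
  unfold toTrace
  rw [List.getElem?_append_right (Nat.le_add_right _ _), Nat.add_sub_cancel_left]

theorem requestAt_lt (h : (toTrace ρ).RequestAt i r p m) : m < ρ.length := by
  obtain ⟨s, hs, -⟩ := h
  exact (List.getElem?_eq_some_iff.1 hs).1

theorem replyAt_lt (h : (toTrace ρ).ReplyAt i a m) : m < ρ.length := by
  obtain ⟨s, hs, -⟩ := h
  exact (List.getElem?_eq_some_iff.1 hs).1

theorem requestAt_append_add (k : ℕ) :
    (toTrace (ρ₁ ++ ρ₂)).RequestAt i r p (ρ₁.length + k) ↔ (toTrace ρ₂).RequestAt i r p k := by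
  unfold Trace.RequestAt; rw [toTrace_append_add]

theorem replyAt_append_add (k : ℕ) :
    (toTrace (ρ₁ ++ ρ₂)).ReplyAt i a (ρ₁.length + k) ↔ (toTrace ρ₂).ReplyAt i a k := by
  unfold Trace.ReplyAt; rw [toTrace_append_add]

theorem requestAt_append_of_lt (h : m < ρ₁.length) :
    (toTrace (ρ₁ ++ ρ₂)).RequestAt i r p m ↔ (toTrace ρ₁).RequestAt i r p m :=
  Trace.requestAt_congr (toTrace_append_of_lt h)

theorem replyAt_append_of_lt (h : m < ρ₁.length) :
    (toTrace (ρ₁ ++ ρ₂)).ReplyAt i a m ↔ (toTrace ρ₁).ReplyAt i a m :=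
  Trace.replyAt_congr (toTrace_append_of_lt h)

theorem answered_append_left (h : (toTrace ρ₁).Answered i r a m n) :
    (toTrace (ρ₁ ++ ρ₂)).Answered i r a m n :=
  h.congr fun _ hk => (toTrace_append_of_lt (hk.trans_lt (replyAt_lt h.2.1))).symm

theorem answered_append_add :
    (toTrace (ρ₁ ++ ρ₂)).Answered i r a (ρ₁.length + m) (ρ₁.length + n) ↔
      (toTrace ρ₂).Answered i r a m n :=
  Trace.Answered.shift toTrace_append_add

theorem requested_append :
    (toTrace (ρ₁ ++ ρ₂)).Requested i r p ↔
      (toTrace ρ₁).Requested i r p ∨ (toTrace ρ₂).Requested i r p := by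
  constructor
  · rintro ⟨m, h⟩
    by_cases hm : m < ρ₁.length
    · exact Or.inl ⟨m, (requestAt_append_of_lt hm).1 h⟩
    · obtain ⟨k, rfl⟩ := Nat.exists_eq_add_of_le (not_lt.1 hm)
      exact Or.inr ⟨k, (requestAt_append_add k).1 h⟩
  · rintro (⟨m, h⟩ | ⟨m, h⟩)
    · exact ⟨m, (requestAt_append_of_lt (requestAt_lt h)).2 h⟩
    · exact ⟨_, (requestAt_append_add m).2 h⟩

theorem pending_append :
    (toTrace (ρ₁ ++ ρ₂)).Pending i r ↔ (toTrace ρ₂).Pending i r ∨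
      ((toTrace ρ₁).Pending i r ∧ ∀ a k, ¬ (toTrace ρ₂).ReplyAt i a k) := by
  constructor
  · rintro ⟨p, m, h, hn⟩
    by_cases hm : m < ρ₁.length
    · refine Or.inr ⟨⟨p, m, (requestAt_append_of_lt hm).1 h, fun k hk a ha => ?_⟩,
        fun a k ha => ?_⟩
      · exact hn k hk a ((replyAt_append_of_lt (replyAt_lt ha)).2 ha)
      · exact hn _ (by omega) a ((replyAt_append_add k).2 ha)
    · obtain ⟨j, rfl⟩ := Nat.exists_eq_add_of_le (not_lt.1 hm)
      refine Or.inl ⟨p, j, (requestAt_append_add j).1 h, fun k hk a ha => ?_⟩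
      exact hn _ (by omega) a ((replyAt_append_add k).2 ha)
  · rintro (⟨p, m, h, hn⟩ | ⟨⟨p, m, h, hn⟩, hr⟩)
    · refine ⟨p, _, (requestAt_append_add m).2 h, fun k hk a ha => ?_⟩
      obtain ⟨k, rfl⟩ := Nat.exists_eq_add_of_le (show ρ₁.length ≤ k by omega)
      exact hn k (by omega) a ((replyAt_append_add k).1 ha)
    · refine ⟨p, m, (requestAt_append_of_lt (requestAt_lt h)).2 h, fun k hk a ha => ?_⟩
      by_cases hkl : k < ρ₁.length
      · exact hn k hk a ((replyAt_append_of_lt hkl).1 ha)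
      · obtain ⟨k, rfl⟩ := Nat.exists_eq_add_of_le (not_lt.1 hkl)
        exact hr a k ((replyAt_append_add k).1 ha)

/-- The last case is a request that crosses the boundary: its answer is the first reply in `ρ₂`,
whatever the position of the request in `ρ₁`. Thus completion in a concatenation depends on `ρ₁`
only through `Pending` and `Done`. -/
theorem done_append :
    (toTrace (ρ₁ ++ ρ₂)).Done i r a ↔ (toTrace ρ₁).Done i r a ∨ (toTrace ρ₂).Done i r a ∨
      ((toTrace ρ₁).Pending i r ∧ (toTrace ρ₂).FirstReply i a) := by
  constructor
  · rintro ⟨m, n, h⟩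
    by_cases hm : m < ρ₁.length
    · by_cases hn : n < ρ₁.length
      · exact Or.inl ⟨m, n, h.congr fun k hk => toTrace_append_of_lt (hk.trans_lt hn)⟩
      · obtain ⟨d, rfl⟩ := Nat.exists_eq_add_of_le (not_lt.1 hn)
        obtain ⟨⟨p, hp⟩, hr, hmn, hf⟩ := h
        refine Or.inr (Or.inr ⟨⟨p, m, (requestAt_append_of_lt hm).1 hp, fun k hk a' ha => ?_⟩,
          d, (replyAt_append_add d).1 hr, fun k hk a' ha => ?_⟩)
        · have := replyAt_lt ha
          exact hf k hk (by omega) a' ((replyAt_append_of_lt this).2 ha)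
        · exact hf _ (by omega) (by omega) a' ((replyAt_append_add k).2 ha)
    · obtain ⟨e, rfl⟩ := Nat.exists_eq_add_of_le (not_lt.1 hm)
      have := h.2.2.1
      obtain ⟨d, rfl⟩ := Nat.exists_eq_add_of_le (show ρ₁.length ≤ n by omega)
      exact Or.inr (Or.inl ⟨e, d, answered_append_add.1 h⟩)
  · rintro (⟨m, n, h⟩ | ⟨m, n, h⟩ | ⟨⟨p, m, h, hn⟩, d, hd, hf⟩)
    · exact ⟨m, n, answered_append_left h⟩
    · exact ⟨_, _, answered_append_add.2 h⟩
    · have hm := requestAt_lt h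
      refine ⟨m, ρ₁.length + d, ⟨p, (requestAt_append_of_lt hm).2 h⟩,
        (replyAt_append_add d).2 hd, by omega, fun k hk hkd a' ha => ?_⟩
      by_cases hkl : k < ρ₁.length
      · exact hn k hk a' ((replyAt_append_of_lt hkl).1 ha)
      · obtain ⟨k, rfl⟩ := Nat.exists_eq_add_of_le (not_lt.1 hkl)
        exact hf k (by omega) a' ((replyAt_append_add k).1 ha)

/-- In `ρ` and `ρ'`, clients have issued the same requests and received the same answers. -/
structure ClientEquiv (ρ ρ' : List (Step P Obj Tx Val State Msg)) : Prop where
  requested : ∀ i r p, (toTrace ρ).Requested i r p ↔ (toTrace ρ').Requested i r p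
  pending : ∀ i r, (toTrace ρ).Pending i r ↔ (toTrace ρ').Pending i r
  done : ∀ i r a, (toTrace ρ).Done i r a ↔ (toTrace ρ').Done i r a

theorem ClientEquiv.refl (ρ : List (Step P Obj Tx Val State Msg)) : ClientEquiv ρ ρ :=
  ⟨fun _ _ _ => Iff.rfl, fun _ _ => Iff.rfl, fun _ _ _ => Iff.rfl⟩

theorem ClientEquiv.trans {ρ'' : List (Step P Obj Tx Val State Msg)} (h : ClientEquiv ρ ρ')
    (h' : ClientEquiv ρ' ρ'') : ClientEquiv ρ ρ'' :=
  ⟨fun i r p => (h.requested i r p).trans (h'.requested i r p),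
    fun i r => (h.pending i r).trans (h'.pending i r),
    fun i r a => (h.done i r a).trans (h'.done i r a)⟩

theorem ClientEquiv.append (h : ClientEquiv ρ ρ') (γ : List (Step P Obj Tx Val State Msg)) :
    ClientEquiv (ρ ++ γ) (ρ' ++ γ) := by
  constructor
  · intro i r p; rw [requested_append, requested_append, h.requested]
  · intro i r; rw [pending_append, pending_append, h.pending]
  · intro i r a; rw [done_append, done_append, h.pending, h.done]

/-- `Allowed` never looks at the times of steps, so it can be expressed by the three predicates that
`ClientEquiv` preserves. -/
theorem allowed_iff :
    (toTrace ρ).Allowed i p r ↔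
      (∀ p' r', (toTrace ρ).Requested i r' p' → p' = p) ∧ (∀ r', ¬ (toTrace ρ).Pending i r') ∧
      ¬ ((∃ j, (toTrace ρ).Done i Request.commit (Reply.ok j)) ∨
        ∃ r, (toTrace ρ).Done i r Reply.abort) ∧
      match r with
      | .read x => ∀ p, ¬ (toTrace ρ).Requested i (Request.read x) p
      | .write x _ => (∃ p, (toTrace ρ).Requested i (Request.read x) p) ∧
          ∀ v p, ¬ (toTrace ρ).Requested i (Request.write x v) p
      | .commit => True := by
  unfold Trace.Allowed
  refine and_congr ?_ (and_congr ?_ (and_congr ?_ ?_))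
  · exact ⟨fun h p' r' hr => h p' ⟨r', hr⟩, fun h p' ⟨r', hr⟩ => h p' r' hr⟩
  · rw [Trace.waiting_iff, not_exists]
  · rw [Trace.terminated_iff]
  · cases r with
    | read x => exact not_exists
    | write x v =>
      refine and_congr Iff.rfl ?_
      exact ⟨fun h v p hr => h ⟨v, p, hr⟩, fun h ⟨v, p, hr⟩ => h v p hr⟩
    | commit => exact Iff.rfl

theorem ClientEquiv.allowed (h : ClientEquiv ρ ρ') (ha : (toTrace ρ).Allowed i p r) :
    (toTrace ρ').Allowed i p r := by
  rw [allowed_iff] at ha ⊢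
  simpa only [h.requested, h.pending, h.done] using ha

theorem Step.Silent.clientEquiv (hs : s.Silent) (ρ : List (Step P Obj Tx Val State Msg)) :
    ClientEquiv (ρ ++ [s]) ρ := by
  have hstep : ∀ m s', toTrace [s] m = some s' → s' = s := by
    intro m s' h
    simpa using List.mem_of_getElem? h
  have hq : ∀ i r p m, ¬ (toTrace [s]).RequestAt i r p m := by
    rintro i r p m ⟨s', h, -, hi⟩
    rw [hstep m s' h, hs.1] at hi
    cases hi
  have ha : ∀ i a m, ¬ (toTrace [s]).ReplyAt i a m := by
    rintro i a m ⟨s', h, hi⟩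
    rw [hstep m s' h, hs.2.2] at hi
    cases hi
  constructor
  · intro i r p
    rw [requested_append]
    exact ⟨fun h => h.elim id fun ⟨m, h⟩ => (hq _ _ _ _ h).elim, Or.inl⟩
  · intro i r
    rw [pending_append]
    exact ⟨fun h => h.elim (fun ⟨_, _, h, _⟩ => (hq _ _ _ _ h).elim) And.left,
      fun h => Or.inr ⟨h, ha i⟩⟩
  · intro i r a
    rw [done_append]
    refine ⟨fun h => ?_, Or.inl⟩
    obtain h | ⟨m, n, h⟩ | ⟨-, n, h, -⟩ := h
    · exact h
    · exact (ha _ _ _ h.2.1).elim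
    · exact (ha _ _ _ h).elim

/-- In `ρ`, all requests are answered positively, and `L` lists them with the processes to which
they are issued and with the answers. -/
structure Log (ρ : List (Step P Obj Tx Val State Msg))
    (L : List (Tx × P × Request Obj Val × Option Tx)) : Prop where
  pending : ∀ i r, ¬ (toTrace ρ).Pending i r
  requested : ∀ i r p, (toTrace ρ).Requested i r p ↔ ∃ j, (i, p, r, j) ∈ L
  done : ∀ i r a, (toTrace ρ).Done i r a ↔ ∃ p j, (i, p, r, j) ∈ L ∧ a = Reply.ok j

variable {L L₁ L₂ : List (Tx × P × Request Obj Val × Option Tx)}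

theorem Log.nil : Log ([] : List (Step P Obj Tx Val State Msg)) [] := by
  have hq : ∀ i r p m, ¬ (toTrace ([] : List (Step P Obj Tx Val State Msg))).RequestAt i r p m :=
    fun i r p m h => absurd (requestAt_lt h) (by simp)
  constructor
  · rintro i r ⟨p, m, h, -⟩; exact hq _ _ _ _ h
  · intro i r p
    simp only [List.not_mem_nil, exists_false, iff_false]
    rintro ⟨m, h⟩; exact hq _ _ _ _ h
  · intro i r a
    simp only [List.not_mem_nil, false_and, exists_false, iff_false]
    rintro ⟨m, n, ⟨p, h⟩, -⟩; exact hq _ _ _ _ h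

theorem Log.append (h₁ : Log ρ₁ L₁) (h₂ : Log ρ₂ L₂) : Log (ρ₁ ++ ρ₂) (L₁ ++ L₂) := by
  constructor
  · intro i r
    rw [pending_append]
    rintro (h | ⟨h, -⟩)
    exacts [h₂.pending _ _ h, h₁.pending _ _ h]
  · intro i r p
    rw [requested_append, h₁.requested, h₂.requested]
    simp only [List.mem_append, exists_or]
  · intro i r a
    rw [done_append, h₁.done, h₂.done]
    have := h₁.pending i r
    simp only [List.mem_append, or_and_right, exists_or, this, false_and, or_false]

theorem Log.clientEquiv (h : Log ρ L) (he : ClientEquiv ρ ρ') : Log ρ' L :=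
  ⟨fun i r => by rw [← he.pending]; exact h.pending i r,
    fun i r p => by rw [← he.requested]; exact h.requested i r p,
    fun i r a => by rw [← he.done]; exact h.done i r a⟩

/-- Both blocks answer all their own requests, so nothing crosses the boundary, and what clients
have seen is the union of the two logs, in which order is irrelevant. -/
theorem Log.clientEquiv_append_comm (h₁ : Log ρ₁ L₁) (h₂ : Log ρ₂ L₂) :
    ClientEquiv (ρ₁ ++ ρ₂) (ρ₂ ++ ρ₁) := by
  have h₁₂ := h₁.append h₂
  have h₂₁ := h₂.append h₁
  constructor
  · intro i r p
    rw [requested_append, requested_append, or_comm]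
  · intro i r
    exact iff_of_false (h₁₂.pending i r) (h₂₁.pending i r)
  · intro i r a
    rw [h₁₂.done, h₂₁.done]
    simp only [List.mem_append, or_comm]

theorem mem_ops_iff {o : Operation Obj Tx} :
    o ∈ (toTrace ρ).ops ↔ (∃ x, o = Operation.write none x) ∨ o = Operation.commit none ∨
      ∃ i r a, (toTrace ρ).Done i r a ∧ o = opOf i r a := by
  constructor
  · rintro (h | h | ⟨i, r, a, m, n, h, ho⟩)
    · exact Or.inl h
    · exact Or.inr (Or.inl h)
    · exact Or.inr (Or.inr ⟨i, r, a, ⟨m, n, h⟩, ho⟩)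
  · rintro (h | h | ⟨i, r, a, ⟨m, n, h⟩, ho⟩)
    · exact Or.inl h
    · exact Or.inr (Or.inl h)
    · exact Or.inr (Or.inr ⟨i, r, a, m, n, h, ho⟩)

theorem Log.mem_ops (h : Log ρ L) {o : Operation Obj Tx} :
    o ∈ (toTrace ρ).ops ↔ (∃ x, o = Operation.write none x) ∨ o = Operation.commit none ∨
      ∃ e ∈ L, o = opOf e.1 e.2.2.1 (Reply.ok e.2.2.2) := by
  rw [mem_ops_iff]
  refine or_congr Iff.rfl (or_congr Iff.rfl ?_)
  simp only [h.done]
  constructor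
  · rintro ⟨i, r, a, ⟨p, j, hL, rfl⟩, ho⟩
    exact ⟨_, hL, ho⟩
  · rintro ⟨⟨i, p, r, j⟩, hL, ho⟩
    exact ⟨i, r, _, ⟨p, j, hL, rfl⟩, ho⟩

theorem Trace.Done.realTime_append {i' : Tx} {r' : Request Obj Val} {a' : Reply Tx}
    (h₁ : (toTrace ρ₁).Done i r a) (h₂ : (toTrace ρ₂).Done i' r' a') :
    (toTrace (ρ₁ ++ ρ₂)).RealTime (opOf i r a) (opOf i' r' a') := by
  obtain ⟨m, n, h⟩ := h₁
  obtain ⟨m', n', h'⟩ := h₂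
  refine .before _ _ _ _ _ _ m n (ρ₁.length + m') (ρ₁.length + n') (answered_append_left h)
    (answered_append_add.2 h') ?_
  have := replyAt_lt h.2.1
  omega

theorem Trace.RealTime.append_right {o o' : Operation Obj Tx} (h : (toTrace ρ₁).RealTime o o') :
    (toTrace (ρ₁ ++ ρ₂)).RealTime o o' := by
  cases h with
  | init x => exact .init x
  | init_write x i r a m n h => exact .init_write x i r a m n (answered_append_left h)
  | init_commit i r a m n h => exact .init_commit i r a m n (answered_append_left h)
  | before i i' r r' a a' m n m' n' h h' hlt =>
    exact .before i i' r r' a a' m n m' n' (answered_append_left h) (answered_append_left h') hlt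

theorem Trace.Done.append_left (h : (toTrace ρ₁).Done i r a) : (toTrace (ρ₁ ++ ρ₂)).Done i r a :=
  done_append.2 (Or.inl h)

theorem Trace.Done.append_right (h : (toTrace ρ₂).Done i r a) :
    (toTrace (ρ₁ ++ ρ₂)).Done i r a :=
  done_append.2 (Or.inr (Or.inl h))

/-- `Tᵢ` precedes `Tⱼ` if it is terminated when `Tⱼ` starts. -/
theorem precedes_append {j : Tx} (hi : (toTrace ρ₁).Terminated i)
    (hj : ∀ r p, ¬ (toTrace ρ₁).Requested j r p) : (toTrace (ρ₁ ++ ρ₂)).Precedes i j := by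
  obtain ⟨n, hn⟩ := hi
  have hlt : n < ρ₁.length := by
    obtain ⟨_, _, h⟩ | ⟨_, _, h⟩ := hn <;> exact replyAt_lt h.2.1
  refine ⟨n, ?_, fun r p m h => ?_⟩
  · obtain ⟨j, m, h⟩ | ⟨r, m, h⟩ := hn
    · exact Or.inl ⟨j, m, answered_append_left h⟩
    · exact Or.inr ⟨r, m, answered_append_left h⟩
  · by_contra hm
    have hm' : m < ρ₁.length := by omega
    exact hj r p ⟨m, (requestAt_append_of_lt hm').1 h⟩

end Lists

/-! ### Executions -/

theorem Config.ext' {c c' : Config P State Msg} (hs : ∀ p, c.state p = c'.state p)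
    (hb : c.buffer = c'.buffer) : c = c' := by
  cases c; cases c'
  congr
  exact funext hs

namespace Protocol

variable {S : Protocol P Obj Tx Val State Msg}
  {ρ ρ' ρ₁ ρ₂ γ : List (Step P Obj Tx Val State Msg)} {s : Step P Obj Tx Val State Msg}
  {c c' c₁ c₂ : Config P State Msg}

/-- The protocol may be nondeterministic, but a step records its outcome, so the list of steps
determines the configuration reached. -/
theorem StepRel.unique (h₁ : S.StepRel c s c₁) (h₂ : S.StepRel c s c₂) : c₁ = c₂ := by
  obtain ⟨-, ha₁, hb₁, hc₁⟩ := h₁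
  obtain ⟨-, ha₂, hb₂, hc₂⟩ := h₂
  refine Config.ext' (fun p => ?_) ?_
  · by_cases hp : p = s.proc
    · rw [hp, ha₁, ha₂]
    · rw [hb₁ p hp, hb₂ p hp]
  · cases hi : s.input with
    | idle => simp only [hi] at hc₁ hc₂; rw [hc₁, hc₂]
    | request i r => simp only [hi] at hc₁ hc₂; rw [hc₁, hc₂]
    | receive m =>
      simp only [hi] at hc₁ hc₂
      obtain ⟨b₁, hb₁, hc₁⟩ := hc₁
      obtain ⟨b₂, hb₂, hc₂⟩ := hc₂
      rw [hb₁, Multiset.cons_inj_right] at hb₂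
      rw [hc₁, hc₂, hb₂]

theorem reaches_snoc_iff :
    S.Reaches (ρ ++ [s]) c' ↔ ∃ c, S.Reaches ρ c ∧ S.StepRel c s c' ∧
      ∀ i r, s.input = Input.request i r → (toTrace ρ).Allowed i s.proc r := by
  constructor
  · intro h
    generalize hσ : ρ ++ [s] = σ at h
    cases h with
    | nil => simp at hσ
    | snoc ρ' c s' c' h hs ha =>
      obtain ⟨rfl, h'⟩ := List.append_inj' hσ rfl
      obtain rfl : s = s' := by simpa using h'
      exact ⟨c, h, hs, ha⟩
  · rintro ⟨c, h, hs, ha⟩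
    exact .snoc ρ c s c' h hs ha

theorem reaches_nil_iff : S.Reaches [] c ↔ c = ⟨S.init, 0⟩ := by
  constructor
  · intro h
    generalize hσ : [] = σ at h
    cases h with
    | nil => rfl
    | snoc ρ' c s' c' h hs ha => simp at hσ
  · rintro rfl; exact .nil

theorem Reaches.unique (h₁ : S.Reaches ρ c₁) (h₂ : S.Reaches ρ c₂) : c₁ = c₂ := by
  induction ρ using List.reverseRecOn generalizing c₁ c₂ with
  | nil => rw [reaches_nil_iff.1 h₁, reaches_nil_iff.1 h₂]
  | append_singleton ρ s ih =>
    obtain ⟨c, h, hs, -⟩ := reaches_snoc_iff.1 h₁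
    obtain ⟨c', h', hs', -⟩ := reaches_snoc_iff.1 h₂
    obtain rfl := ih h h'
    exact hs.unique hs'

theorem Reaches.prefix (h : S.Reaches (ρ₁ ++ ρ₂) c) : ∃ c', S.Reaches ρ₁ c' := by
  induction ρ₂ using List.reverseRecOn generalizing c with
  | nil => exact ⟨c, by simpa using h⟩
  | append_singleton ρ s ih =>
    rw [← List.append_assoc] at h
    obtain ⟨c', h', -⟩ := reaches_snoc_iff.1 h
    exact ih h'

theorem Reaches.state_eq_init {p : P} (h : S.Reaches ρ c) (hp : ∀ s ∈ ρ, s.proc ≠ p) :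
    c.state p = S.init p := by
  induction ρ using List.reverseRecOn generalizing c with
  | nil => rw [reaches_nil_iff.1 h]
  | append_singleton ρ s ih =>
    obtain ⟨c', h', hs, -⟩ := reaches_snoc_iff.1 h
    rw [hs.2.2.1 p (hp s (by simp)).symm]
    exact ih h' fun s hs => hp s (by simp [hs])

/-- Two executions that reach the same configuration and that clients do not distinguish have the
same continuations. -/
theorem Reaches.transfer (h : S.Reaches ρ c) (h' : S.Reaches ρ' c) (he : ClientEquiv ρ ρ')
    (hγ : S.Reaches (ρ ++ γ) c') : S.Reaches (ρ' ++ γ) c' := by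
  induction γ using List.reverseRecOn generalizing c' with
  | nil =>
    rw [List.append_nil] at hγ ⊢
    rwa [hγ.unique h]
  | append_singleton γ s ih =>
    rw [← List.append_assoc] at hγ ⊢
    obtain ⟨d, hd, hs, ha⟩ := reaches_snoc_iff.1 hγ
    exact reaches_snoc_iff.2 ⟨d, ih hd, hs, fun i r hi => (he.append γ).allowed (ha i r hi)⟩

/-- Steps of the same process from configurations that agree on its state: the messages in transit
differ by `b`. -/
theorem StepRel.frame {d : Config P State Msg} {b : Multiset (P × Msg)} (h : S.StepRel c s c')
    (hs : d.state s.proc = c.state s.proc) (hb : d.buffer = b + c.buffer) :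
    ∃ d', S.StepRel d s d' ∧ d'.state s.proc = c'.state s.proc ∧
      (∀ p, p ≠ s.proc → d'.state p = d.state p) ∧ d'.buffer = b + c'.buffer := by
  classical
  obtain ⟨hn, h₁, h₂, h₃⟩ := h
  refine ⟨⟨Function.update d.state s.proc s.outcome.state, b + c'.buffer⟩, ⟨?_, ?_, ?_, ?_⟩, ?_,
    ?_, rfl⟩
  · rwa [hs]
  · simp
  · intro p hp; simp [hp]
  · cases hi : s.input with
    | idle => simp only [hi] at h₃ ⊢; rw [h₃, hb, add_assoc]
    | request i r => simp only [hi] at h₃ ⊢; rw [h₃, hb, add_assoc]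
    | receive m =>
      simp only [hi] at h₃ ⊢
      obtain ⟨rest, hr, hc⟩ := h₃
      refine ⟨b + rest, ?_, ?_⟩
      · rw [hb, hr, Multiset.add_cons]
      · rw [hc, add_assoc]
  · simp [h₁]
  · intro p hp; simp [hp]

/-- Silent steps of the processes outside `U` can be removed if these make no other steps. -/
theorem Reaches.filter {U : Set P} [DecidablePred fun s : Step P Obj Tx Val State Msg => s.proc ∈ U]
    (h : S.Reaches ρ c) (hU : ∀ s ∈ ρ, ¬ s.Silent → s.proc ∈ U) :
    ClientEquiv ρ (ρ.filter (·.proc ∈ U)) ∧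
      ∃ c', S.Reaches (ρ.filter (·.proc ∈ U)) c' ∧ c'.buffer = c.buffer ∧
        ∀ p ∈ U, c'.state p = c.state p := by
  induction ρ using List.reverseRecOn generalizing c with
  | nil => exact ⟨ClientEquiv.refl _, c, h, rfl, fun _ _ => rfl⟩
  | append_singleton ρ s ih =>
    obtain ⟨d, hd, hs, ha⟩ := reaches_snoc_iff.1 h
    obtain ⟨he, d', hd', hb, hst⟩ := ih hd fun s hs => hU s (by simp [hs])
    rw [List.filter_append]
    by_cases hsU : s.proc ∈ U
    · have hf : [s].filter (·.proc ∈ U) = [s] := by simp [hsU]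
      rw [hf]
      obtain ⟨c', hc', h₁, h₂, h₃⟩ := hs.frame (d := d') (b := 0) (hst _ hsU) (by simpa using hb)
      refine ⟨he.append _, c', reaches_snoc_iff.2 ⟨d', hd', hc', fun i r hi =>
        he.allowed (ha i r hi)⟩, by simpa using h₃, fun p hp => ?_⟩
      by_cases hps : p = s.proc
      · rw [hps, h₁]
      · rw [h₂ p hps, hst p hp, hs.2.2.1 p hps]
    · have hf : [s].filter (·.proc ∈ U) = [] := by simp [hsU]
      rw [hf, List.append_nil]
      -- A step outside `U` is silent: removing it changes neither the messages in transit, nor the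
      -- states in `U`, nor what clients see.
      have hsil : s.Silent := by
        by_contra hn; exact hsU (hU s (by simp) hn)
      refine ⟨(hsil.clientEquiv ρ).trans he, d', hd', ?_, fun p hp => ?_⟩
      · have h₃ := hs.2.2.2
        simp only [hsil.1, hsil.2.1, add_zero] at h₃
        rw [hb, h₃]
      · rw [hst p hp, hs.2.2.1 p]
        rintro rfl; exact hsU hp

/-- Executions of disjoint sets of processes for different clients can be concatenated. -/
theorem Reaches.append_of_disjoint {U : Set P} (h₁ : S.Reaches ρ₁ c₁) (h₂ : S.Reaches ρ₂ c₂)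
    (hU₁ : ∀ s ∈ ρ₁, s.proc ∈ U) (hU₂ : ∀ s ∈ ρ₂, s.proc ∉ U)
    (hq : ∀ i r, ¬ (toTrace ρ₁).Pending i r)
    (htx : ∀ i r p r' p', (toTrace ρ₁).Requested i r p → ¬ (toTrace ρ₂).Requested i r' p') :
    ∃ c, S.Reaches (ρ₁ ++ ρ₂) c ∧ c.buffer = c₁.buffer + c₂.buffer ∧
      (∀ p ∈ U, c.state p = c₁.state p) ∧ ∀ p ∉ U, c.state p = c₂.state p := by
  induction ρ₂ using List.reverseRecOn generalizing c₂ with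
  | nil =>
    rw [reaches_nil_iff.1 h₂, List.append_nil]
    refine ⟨c₁, h₁, by simp, fun _ _ => rfl, fun p hp => ?_⟩
    exact h₁.state_eq_init fun s hs he => hp (he ▸ hU₁ s hs)
  | append_singleton ρ s ih =>
    obtain ⟨d, hd, hs, ha⟩ := reaches_snoc_iff.1 h₂
    obtain ⟨e, he, hb, hst, hst'⟩ := ih hd (fun s hs => hU₂ s (by simp [hs]))
      fun i r p r' p' h h' => htx i r p r' p' h (requested_append.2 (Or.inl h'))
    have hsU := hU₂ s (by simp)
    obtain ⟨c', hc', g₁, g₂, g₃⟩ := hs.frame (d := e) (hst' _ hsU) hb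
    rw [← List.append_assoc]
    refine ⟨c', reaches_snoc_iff.2 ⟨e, he, hc', fun i r hi => ?_⟩, g₃, fun p hp => ?_,
      fun p hp => ?_⟩
    -- The client that issues a request in `s` has issued none in `ρ₁`, so prefixing `ρ₁` does not
    -- affect whether the request is allowed.
    · have hr : (toTrace (ρ ++ [s])).Requested i r s.proc :=
        requested_append.2 (Or.inr ⟨0, s, rfl, rfl, hi⟩)
      have hn : ∀ r p, ¬ (toTrace ρ₁).Requested i r p := fun r' p h => htx _ _ _ _ _ h hr
      have hd' : ∀ r a, ¬ (toTrace ρ₁).Done i r a := by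
        rintro r a ⟨m, n, ⟨p, h⟩, -⟩; exact hn r p ⟨m, h⟩
      have := ha i r hi
      rw [allowed_iff] at this ⊢
      simpa only [requested_append, pending_append, done_append, hn, hd', hq, false_or, or_false,
        false_and] using this
    · rw [g₂ p (by rintro rfl; exact hsU hp), hst p hp]
    · by_cases hps : p = s.proc
      · rw [hps, g₁]
      · rw [g₂ p hps, hst' p hp, hs.2.2.1 p hps]

/-! ### Fair extensions -/

/-- A message in transit is received in the next step, or remains in transit. -/
theorem StepRel.mem_buffer {p : P} {m : Msg} (h : S.StepRel c s c') (hm : (p, m) ∈ c.buffer) :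
    (s.proc = p ∧ s.input = Input.receive m) ∨ (p, m) ∈ c'.buffer := by
  have h₃ := h.2.2.2
  cases hi : s.input with
  | idle => simp only [hi] at h₃; right; rw [h₃]; exact Multiset.mem_add.2 (Or.inl hm)
  | request i r => simp only [hi] at h₃; right; rw [h₃]; exact Multiset.mem_add.2 (Or.inl hm)
  | receive m' =>
    simp only [hi] at h₃
    obtain ⟨rest, hr, hc⟩ := h₃
    rw [hr, Multiset.mem_cons] at hm
    obtain hm | hm := hm
    · left; cases hm; exact ⟨rfl, rfl⟩
    · right; rw [hc]; exact Multiset.mem_add.2 (Or.inl hm)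

/-- Messages in transit, `q`, in the order in which they are to be received, and process states. -/
structure Queue (P State Msg : Type*) where
  state : P → State
  queue : List (P × Msg)

/-- The corresponding configuration. -/
def Queue.config (q : Queue P State Msg) : Config P State Msg := ⟨q.state, q.queue⟩

/-- Process `p` makes a step with input `e`. -/
noncomputable def stepOf (S : Protocol P Obj Tx Val State Msg) (q : Queue P State Msg) (p : P)
    (e : Input Obj Tx Val Msg) : Step P Obj Tx Val State Msg :=
  ⟨p, e, (S.next_nonempty p (q.state p) e).some⟩

open Classical in
/-- The effect of a step that leaves the messages `rest` in transit. -/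
noncomputable def Queue.after (q : Queue P State Msg) (s : Step P Obj Tx Val State Msg)
    (rest : List (P × Msg)) : Queue P State Msg :=
  -- New messages join the end of the queue, so only finitely many deliveries precede that of a
  -- given message.
  ⟨Function.update q.state s.proc s.outcome.state, rest ++ s.outcome.sends.toList⟩

/-- Either the process `p` makes an idle step, or the oldest message is received. -/
noncomputable def schedule (S : Protocol P Obj Tx Val State Msg) (deliver : Bool) (p : P)
    (q : Queue P State Msg) : Step P Obj Tx Val State Msg × Queue P State Msg :=
  match deliver, q.queue with
  | true, m :: rest =>
    let s := S.stepOf q m.1 (Input.receive m.2)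
    (s, q.after s rest)
  | _, _ =>
    let s := S.stepOf q p Input.idle
    (s, q.after s q.queue)

theorem schedule_idle (p : P) (q : Queue P State Msg) :
    S.schedule false p q =
      (S.stepOf q p Input.idle, q.after (S.stepOf q p Input.idle) q.queue) := by
  simp [schedule]

theorem schedule_nil (p : P) (q : Queue P State Msg) (b : Bool) (h : q.queue = []) :
    S.schedule b p q = (S.stepOf q p Input.idle, q.after (S.stepOf q p Input.idle) []) := by
  cases b <;> simp [schedule, h]

theorem schedule_cons (p : P) (q : Queue P State Msg) {m : P × Msg} {rest : List (P × Msg)}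
    (h : q.queue = m :: rest) :
    S.schedule true p q = (S.stepOf q m.1 (Input.receive m.2),
      q.after (S.stepOf q m.1 (Input.receive m.2)) rest) := by
  simp [schedule, h]

theorem stepRel_idle (q : Queue P State Msg) (p : P) :
    S.StepRel q.config (S.stepOf q p Input.idle)
      (q.after (S.stepOf q p Input.idle) q.queue).config := by
  refine ⟨(S.next_nonempty p (q.state p) Input.idle).some_mem, ?_, ?_, ?_⟩
  · simp [Queue.config, Queue.after]
  · intro p' hp; simp [Queue.config, Queue.after, hp]
  · simp [Queue.config, Queue.after, stepOf, ← Multiset.coe_add]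

theorem stepRel_receive (q : Queue P State Msg) {m : P × Msg} {rest : List (P × Msg)}
    (h : q.queue = m :: rest) :
    S.StepRel q.config (S.stepOf q m.1 (Input.receive m.2))
      (q.after (S.stepOf q m.1 (Input.receive m.2)) rest).config := by
  refine ⟨(S.next_nonempty m.1 (q.state m.1) (Input.receive m.2)).some_mem, ?_, ?_, ?_⟩
  · simp [Queue.config, Queue.after]
  · intro p' hp; simp [Queue.config, Queue.after, hp]
  · exact ⟨rest, by simp [Queue.config, h, stepOf],
      by simp [Queue.config, Queue.after, stepOf, ← Multiset.coe_add]⟩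

theorem stepRel_schedule (b : Bool) (p : P) (q : Queue P State Msg) :
    S.StepRel q.config (S.schedule b p q).1 (S.schedule b p q).2.config := by
  cases b with
  | false => rw [schedule_idle]; exact stepRel_idle q p
  | true =>
    cases h : q.queue with
    | nil =>
      rw [schedule_nil p q true h]
      have := stepRel_idle (S := S) q p
      rwa [h] at this
    | cons m rest => rw [schedule_cons p q h]; exact stepRel_receive q h

theorem schedule_input (b : Bool) (p : P) (q : Queue P State Msg) (i : Tx)
    (r : Request Obj Val) : (S.schedule b p q).1.input ≠ Input.request i r := by
  cases b with
  | false => rw [schedule_idle]; exact nofun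
  | true =>
    cases h : q.queue with
    | nil => rw [schedule_nil p q true h]; exact nofun
    | cons m rest => rw [schedule_cons p q h]; exact nofun

/-- Every execution of finitely many processes has a fair extension without new requests. -/
theorem Reaches.exists_fair [Finite P] [Nonempty P] (h : S.Reaches ρ c) :
    ∃ σ : ℕ → Step P Obj Tx Val State Msg, S.IsFairExecution σ ∧
      (∀ m < ρ.length, ofSeq σ m = toTrace ρ m) ∧
      ∀ m, ρ.length ≤ m → ∀ i r, (σ m).input ≠ Input.request i r := by
  obtain ⟨f, hf⟩ := exists_surjective_nat P
  -- Reading a natural number as a pair makes every process recur infinitely often: `Nat.pair a n`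
  -- is at least `n` and has first component `a`.
  have he : ∀ p n, ∃ k, n ≤ k ∧ f (Nat.unpair k).1 = p := by
    intro p n
    obtain ⟨a, rfl⟩ := hf p
    exact ⟨Nat.pair a n, Nat.right_le_pair a n, by simp⟩
  -- Even turns are idle steps of the processes in the order above; odd turns deliver the oldest
  -- message, if there is one.
  let next (n : ℕ) (q : Queue P State Msg) :=
    S.schedule (decide (n % 2 = 1)) (f (Nat.unpair (n / 2)).1) q
  let N : ℕ → Queue P State Msg :=
    fun n => Nat.rec ⟨c.state, c.buffer.toList⟩ (fun n q => (next n q).2) n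
  let t : ℕ → Step P Obj Tx Val State Msg := fun n => (next n (N n)).1
  have hN : ∀ n, N (n + 1) = (next n (N n)).2 := fun n => rfl
  have hN0 : (N 0).config = c := by
    simp [N, Queue.config]
  have htN : ∀ n, S.StepRel (N n).config (t n) (N (n + 1)).config :=
    fun n => stepRel_schedule _ _ _
  let σ : ℕ → Step P Obj Tx Val State Msg :=
    fun m => if hm : m < ρ.length then ρ[m] else t (m - ρ.length)
  have hσρ : ∀ m (hm : m < ρ.length), σ m = ρ[m] := fun m hm => dif_pos hm
  have hσt : ∀ k, σ (ρ.length + k) = t k := by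
    intro k; simp [σ]
  have hpre : (List.range ρ.length).map σ = ρ := by
    apply List.ext_getElem (by simp)
    intro m h₁ h₂
    simp [hσρ m h₂]
  have hR : ∀ k, S.Reaches ((List.range (ρ.length + k)).map σ) (N k).config := by
    intro k
    induction k with
    | zero => rw [add_zero, hpre, hN0]; exact h
    | succ k ih =>
      rw [← add_assoc, List.range_succ, List.map_append, List.map_singleton, hσt]
      exact reaches_snoc_iff.2 ⟨_, ih, htN k, fun i r hi => (schedule_input _ _ _ i r hi).elim⟩
  have hex : ∀ n, ∃ c, S.Reaches ((List.range n).map σ) c := by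
    intro n
    have := hR n
    rw [add_comm, List.range_add, List.map_append] at this
    exact this.prefix
  -- Induction on the list `l` of older messages: each odd turn removes the head of the queue, and
  -- an even turn only appends at the end.
  have hdel : ∀ (l : List (P × Msg)) (m : P × Msg) (l' : List (P × Msg)) (k : ℕ),
      (N k).queue = l ++ m :: l' →
      ∃ k', k ≤ k' ∧ (t k').proc = m.1 ∧ (t k').input = Input.receive m.2 := by
    intro l
    induction l with
    | nil =>
      have hodd : ∀ (m : P × Msg) (l' : List (P × Msg)) (k : ℕ), k % 2 = 1 →
          (N k).queue = m :: l' → (t k).proc = m.1 ∧ (t k).input = Input.receive m.2 := by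
        intro m l' k hk hq
        have : t k = S.stepOf (N k) m.1 (Input.receive m.2) := by
          simp only [t, next, hk, decide_true]
          rw [schedule_cons _ _ hq]
        rw [this]; exact ⟨rfl, rfl⟩
      intro m l' k hq
      by_cases hk : k % 2 = 1
      · exact ⟨k, le_rfl, hodd m l' k hk hq⟩
      · have hq' : (N (k + 1)).queue = m :: (l' ++ (t k).outcome.sends.toList) := by
          simp only [hN, t, next, hk, decide_false, schedule_idle, Queue.after]
          rw [hq]; rfl
        exact ⟨k + 1, by omega, hodd m _ (k + 1) (by omega) hq'⟩
    | cons a l ih =>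
      have hodd : ∀ (m : P × Msg) (l' : List (P × Msg)) (k : ℕ), k % 2 = 1 →
          (N k).queue = a :: (l ++ m :: l') →
          ∃ k', k ≤ k' ∧ (t k').proc = m.1 ∧ (t k').input = Input.receive m.2 := by
        intro m l' k hk hq
        have hq' : (N (k + 1)).queue = l ++ m :: (l' ++ (t k).outcome.sends.toList) := by
          simp only [hN, t, next, hk, decide_true]
          rw [schedule_cons _ _ hq]
          simp [Queue.after]
        obtain ⟨k', hk', h⟩ := ih m _ (k + 1) hq'
        exact ⟨k', by omega, h⟩
      intro m l' k hq
      by_cases hk : k % 2 = 1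
      · exact hodd m l' k hk hq
      · have hq' : (N (k + 1)).queue = a :: (l ++ m :: (l' ++ (t k).outcome.sends.toList)) := by
          simp only [hN, t, next, hk, decide_false, schedule_idle, Queue.after]
          rw [hq]; simp
        obtain ⟨k', hk', h⟩ := hodd m _ (k + 1) (by omega) hq'
        exact ⟨k', by omega, h⟩
  have hfair : ∀ n c, S.Reaches ((List.range n).map σ) c → ∀ p m, (p, m) ∈ c.buffer → n ≤ ρ.length →
      ∃ k, n ≤ k ∧ (σ k).proc = p ∧ (σ k).input = Input.receive m := by
    intro n c' hc p m hm hn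
    -- A message in transit before the end of `ρ` is either received by the next step or still in
    -- transit after it; backward induction starts from the end of `ρ`, where the queue takes over.
    induction hn using Nat.decreasingInduction generalizing c' with
    | self =>
      have := hc.unique (hR 0)
      subst this
      have hm' : (p, m) ∈ (N 0).queue := by simpa [Queue.config] using hm
      obtain ⟨l, l', hl⟩ := List.append_of_mem hm'
      obtain ⟨k, -, hk⟩ := hdel l _ l' 0 hl
      exact ⟨ρ.length + k, by omega, by rwa [hσt]⟩
    | of_succ n hn ih =>
      obtain ⟨d, hd⟩ := hex (n + 1)
      have hd' := hd
      rw [List.range_succ, List.map_append, List.map_singleton] at hd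
      obtain ⟨e, he, hs, -⟩ := reaches_snoc_iff.1 hd
      obtain rfl := he.unique hc
      obtain h | h := hs.mem_buffer hm
      · exact ⟨n, le_rfl, h⟩
      · obtain ⟨k, hk, h⟩ := ih d hd' h
        exact ⟨k, by omega, h⟩
  refine ⟨σ, ⟨hex, ?_, ?_⟩, ?_, ?_⟩
  · intro p n
    obtain ⟨k, hk, hp⟩ := he p n
    refine ⟨ρ.length + 2 * k, by omega, ?_, ?_⟩
    · rw [hσt]
      have h2 : 2 * k % 2 ≠ 1 := by omega
      have h3 : 2 * k / 2 = k := by omega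
      simp only [t, next, h2, decide_false, schedule_idle, h3, hp]
      rfl
    · intro i r; rw [hσt]; exact schedule_input _ _ _ _ _
  · intro n c' hc p m hm
    by_cases hn : n ≤ ρ.length
    · exact hfair n c' hc p m hm hn
    · obtain ⟨k, rfl⟩ := Nat.exists_eq_add_of_le (not_le.1 hn).le
      have := hc.unique (hR k)
      subst this
      have hm' : (p, m) ∈ (N k).queue := by simpa [Queue.config] using hm
      obtain ⟨l, l', hl⟩ := List.append_of_mem hm'
      obtain ⟨k', hk', h⟩ := hdel l _ l' k hl
      exact ⟨ρ.length + k', by omega, by rwa [hσt]⟩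
  · intro m hm
    simp only [ofSeq, toTrace, hσρ m hm, List.getElem?_eq_getElem hm]
  · intro m hm i r
    obtain ⟨k, rfl⟩ := Nat.exists_eq_add_of_le hm
    rw [hσt]; exact schedule_input _ _ _ _ _

end Protocol

/-! ### Precedence of transactions, and the requests that a log allows. -/

section Lists

variable {ρ ρ₁ ρ₂ : List (Step P Obj Tx Val State Msg)} {i j : Tx} {r : Request Obj Val} {p : P}
  {L : List (Tx × P × Request Obj Val × Option Tx)}

theorem terminatedAt_lt {n : ℕ} (h : (toTrace ρ).TerminatedAt i n) : n < ρ.length := by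
  obtain ⟨_, _, h⟩ | ⟨_, _, h⟩ := h <;> exact replyAt_lt h.2.1

theorem Trace.TerminatedAt.congr {τ τ' : Trace P Obj Tx Val State Msg} {n : ℕ}
    (he : ∀ k ≤ n, τ k = τ' k) (h : τ.TerminatedAt i n) : τ'.TerminatedAt i n := by
  obtain ⟨_, _, h⟩ | ⟨_, _, h⟩ := h
  · exact Or.inl ⟨_, _, h.congr he⟩
  · exact Or.inr ⟨_, _, h.congr he⟩

theorem Trace.Precedes.append (h : (toTrace ρ₁).Precedes i j) :
    (toTrace (ρ₁ ++ ρ₂)).Precedes i j := by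
  obtain ⟨n, hn, h⟩ := h
  have hlt := terminatedAt_lt hn
  refine ⟨n, hn.congr fun k hk => (toTrace_append_of_lt (by omega)).symm, fun r p m hm => ?_⟩
  by_cases hml : m < ρ₁.length
  · exact h r p m ((requestAt_append_of_lt hml).1 hm)
  · omega

theorem Log.allowed_iff (h : Log ρ L) :
    (toTrace ρ).Allowed i p r ↔
      (∀ e ∈ L, e.1 = i → e.2.1 = p ∧ e.2.2.1 ≠ Request.commit) ∧
      match r with
      | .read x => ∀ e ∈ L, e.1 = i → e.2.2.1 ≠ Request.read x
      | .write x _ => (∃ e ∈ L, e.1 = i ∧ e.2.2.1 = Request.read x) ∧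
          ∀ e ∈ L, e.1 = i → ∀ v, e.2.2.1 ≠ Request.write x v
      | .commit => True := by
  rw [PartialReplication.allowed_iff, ← and_assoc, ← and_assoc]
  refine and_congr ?_ ?_
  · simp only [h.requested, h.done, h.pending]
    constructor
    · rintro ⟨⟨h₁, -⟩, h₂⟩ ⟨i', p', r', j'⟩ he rfl
      refine ⟨h₁ p' r' ⟨j', he⟩, ?_⟩
      rintro rfl
      exact h₂ (Or.inl ⟨j', p', j', he, rfl⟩)
    · intro h'
      refine ⟨⟨fun p' r' ⟨j', he⟩ => (h' _ he rfl).1, fun _ h => h⟩, ?_⟩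
      rintro (⟨j', p', k, he, -⟩ | ⟨_, _, _, -, he⟩)
      · exact (h' _ he rfl).2 rfl
      · cases he
  · cases r with
    | read x =>
      simp only [h.requested]
      exact ⟨fun h' e he hi hr => h' e.2.1 ⟨e.2.2.2, by rw [← hi, ← hr]; exact he⟩,
        fun h' p ⟨j, hj⟩ => h' _ hj rfl rfl⟩
    | write x v =>
      simp only [h.requested]
      refine and_congr ?_ ?_
      · exact ⟨fun ⟨p, j, h'⟩ => ⟨_, h', rfl, rfl⟩,
          fun ⟨e, he, hi, hr⟩ => ⟨e.2.1, e.2.2.2, by rw [← hi, ← hr]; exact he⟩⟩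
      · exact ⟨fun h' e he hi v hr => h' v e.2.1 ⟨e.2.2.2, by rw [← hi, ← hr]; exact he⟩,
          fun h' v p ⟨j, hj⟩ => h' _ hj rfl v rfl⟩
    | commit => exact Iff.rfl

theorem Log.writes_iff (h : Log ρ L) {x : Obj} :
    (toTrace ρ).Writes i x ↔ ∃ e ∈ L, e.1 = i ∧ ∃ v, e.2.2.1 = Request.write x v := by
  constructor
  · rintro ⟨v, p, hm⟩
    obtain ⟨j, hj⟩ := (h.requested i _ p).1 hm
    exact ⟨_, hj, rfl, v, rfl⟩
  · rintro ⟨⟨i, p, r, j⟩, he, rfl, v, rfl⟩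
    exact ⟨v, p, (h.requested _ _ p).2 ⟨j, he⟩⟩

theorem Log.terminated (h : Log ρ L) {k : Option Tx} (he : (i, p, Request.commit, k) ∈ L) :
    (toTrace ρ).Terminated i :=
  Trace.terminated_iff.2 (Or.inl ⟨k, (h.done _ _ _).2 ⟨p, k, he, rfl⟩⟩)

end Lists

/-! ### Running requests and transactions to completion, and the effect of genuineness. -/

namespace Protocol

variable {S : Protocol P Obj Tx Val State Msg} {replicas : Obj → Set P}
  {ρ : List (Step P Obj Tx Val State Msg)}
  {L : List (Tx × P × Request Obj Val × Option Tx)}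

theorem exists_request_step {c : Config P State Msg} {i : Tx} {r : Request Obj Val} {p : P}
    (h : S.Reaches ρ c) (ha : (toTrace ρ).Allowed i p r) :
    ∃ s c', s.proc = p ∧ s.input = Input.request i r ∧ S.Reaches (ρ ++ [s]) c' := by
  classical
  let s : Step P Obj Tx Val State Msg :=
    ⟨p, Input.request i r, (S.next_nonempty p (c.state p) (Input.request i r)).some⟩
  refine ⟨s, ⟨Function.update c.state p s.outcome.state, c.buffer + s.outcome.sends⟩, rfl, rfl,
    reaches_snoc_iff.2 ⟨c, h, ⟨?_, ?_, ?_, rfl⟩, ?_⟩⟩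
  · exact (S.next_nonempty p (c.state p) (Input.request i r)).some_mem
  · simp [s]
  · intro p' hp; exact Function.update_of_ne hp _ _
  · intro i' r' he
    cases he
    exact ha

/-- If no concurrent transaction write-conflicts with `Tᵢ`, its next request can be executed
successfully without further requests. -/
theorem exists_call [Finite P] (hOFU : S.OFU) (hWFQ : S.WFQ) (hρ : S.IsExecution ρ) {i : Tx}
    {p : P} {r : Request Obj Val} (ha : (toTrace ρ).Allowed i p r)
    (hc : ∀ j x, j ≠ i → ((toTrace ρ).Writes i x ∨ ∃ v, r = Request.write x v) →
      (toTrace ρ).Writes j x → (toTrace ρ).Precedes j i) :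
    ∃ ρ' j, S.IsExecution (ρ ++ ρ') ∧ Log ρ' [(i, p, r, j)] := by
  have : Nonempty P := ⟨p⟩
  obtain ⟨c, h⟩ := hρ
  obtain ⟨s, c', hsp, hsi, h'⟩ := exists_request_step h ha
  obtain ⟨σ, hσ, hpre, hpost⟩ := h'.exists_fair
  rw [List.length_append, List.length_singleton] at hpre hpost
  have hpre' : ∀ m < ρ.length, ofSeq σ m = toTrace ρ m := fun m hm => by
    rw [hpre m (by omega), toTrace_append_of_lt hm]
  have hs : σ ρ.length = s := by
    have := hpre ρ.length (by omega)
    rw [← add_zero ρ.length, toTrace_append_add] at this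
    exact Option.some.inj this
  have hreq : ∀ {i' r' p' m}, (ofSeq σ).RequestAt i' r' p' m →
      (m < ρ.length ∧ (toTrace ρ).RequestAt i' r' p' m) ∨
        (m = ρ.length ∧ i' = i ∧ r' = r ∧ p' = p) := by
    intro i' r' p' m hm
    rcases lt_trichotomy m ρ.length with hlt | rfl | hlt
    · exact Or.inl ⟨hlt, (Trace.requestAt_congr (hpre' m hlt)).1 hm⟩
    · obtain ⟨s', he, hp, hi⟩ := hm
      cases he
      rw [hs] at hp hi
      rw [hsi] at hi
      cases hi
      exact Or.inr ⟨rfl, rfl, rfl, hp.symm.trans hsp⟩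
    · obtain ⟨s', he, hp, hi⟩ := hm
      cases he
      exact (hpost m hlt _ _ hi).elim
  have hreq' : (ofSeq σ).RequestAt i r p ρ.length :=
    ⟨s, by rw [← hs]; rfl, hsp, hsi⟩
  -- The fair extension contains no request beyond `r`, so every conflict in it is already covered
  -- by `hc`.
  have hnc : (ofSeq σ).NoConcurrentWriteConflict i := by
    rintro j x hj ⟨v, p₁, m₁, h₁⟩ ⟨w, p₂, m₂, h₂⟩
    right
    have hw : (toTrace ρ).Writes j x := by
      obtain ⟨-, h₂⟩ | ⟨-, h₂, -⟩ := hreq h₂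
      · exact ⟨w, p₂, m₂, h₂⟩
      · exact (hj h₂).elim
    have hw' : (toTrace ρ).Writes i x ∨ ∃ v, r = Request.write x v := by
      obtain ⟨-, h₁⟩ | ⟨-, -, h₁, -⟩ := hreq h₁
      · exact Or.inl ⟨v, p₁, m₁, h₁⟩
      · exact Or.inr ⟨v, h₁.symm⟩
    obtain ⟨n, hn, hb⟩ := hc j x hj hw' hw
    have hlt := terminatedAt_lt hn
    refine ⟨n, hn.congr fun k hk => (hpre' k (by omega)).symm, fun r' p' m hm => ?_⟩
    obtain ⟨-, hm⟩ | ⟨rfl, -⟩ := hreq hm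
    · exact hb _ _ _ hm
    · exact hlt
  -- Whether `Tᵢ` counts as an update or as a query is decided in the infinite execution, where its
  -- requests are final.
  obtain ⟨a, n, han, hne⟩ : ∃ a n, (ofSeq σ).Answered i r a ρ.length n ∧ a ≠ Reply.abort := by
    by_cases hw : ∃ x, (ofSeq σ).Writes i x
    · obtain ⟨h₁, h₂⟩ := hOFU σ hσ i hw
      obtain ⟨a, n, han⟩ := h₁ r p _ hreq'
      exact ⟨a, n, han, by rintro rfl; exact h₂ hnc _ _ _ han⟩
    · obtain ⟨h₁, h₂⟩ := hWFQ σ hσ i hw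
      obtain ⟨a, n, han⟩ := h₁ r p _ hreq'
      exact ⟨a, n, han, by rintro rfl; exact h₂ _ _ _ han⟩
  obtain ⟨j, rfl⟩ : ∃ j, a = Reply.ok j := by
    cases a with
    | ok j => exact ⟨j, rfl⟩
    | abort => exact (hne rfl).elim
  obtain ⟨d, rfl⟩ := Nat.exists_eq_add_of_le han.2.2.1
  -- The extension is cut just after the answer, given in step `ρ.length + d`; hence the length `d +
  -- 1`.
  let ρ' := (List.range (d + 1)).map fun k => σ (ρ.length + k)
  have hρρ' : ρ ++ ρ' = (List.range (ρ.length + (d + 1))).map σ := by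
    rw [List.range_add, List.map_append, List.map_map]
    congr 1
    apply List.ext_getElem (by simp)
    intro m h₁ h₂
    have := hpre' m h₁
    simp only [ofSeq, toTrace, List.getElem?_eq_getElem h₁, Option.some.injEq] at this
    simp [this]
  have htr : ∀ k ≤ d, toTrace ρ' k = ofSeq σ (ρ.length + k) := by
    intro k hk
    have : k < d + 1 := by omega
    simp [toTrace, ρ', ofSeq, this]
  have hans : (toTrace ρ').Answered i r (Reply.ok j) 0 d := by
    have h₁ := (Trace.Answered.shift (τ' := fun k => ofSeq σ (ρ.length + k)) (m := 0)
      (fun _ => rfl)).1 han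
    exact h₁.congr fun k hk => (htr k hk).symm
  have hreqρ' : ∀ {i' r' p' m}, (toTrace ρ').RequestAt i' r' p' m →
      m = 0 ∧ i' = i ∧ r' = r ∧ p' = p := by
    intro i' r' p' m hm
    have hlt := requestAt_lt hm
    have hmd : m ≤ d := by simp [ρ'] at hlt; omega
    have hm' : (ofSeq σ).RequestAt i' r' p' (ρ.length + m) := by
      unfold Trace.RequestAt at hm ⊢
      rwa [← htr m hmd]
    obtain ⟨h, -⟩ | ⟨h, h'⟩ := hreq hm'
    · omega
    · exact ⟨by omega, h'⟩
  refine ⟨ρ', j, ?_, ⟨?_, ?_, ?_⟩⟩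
  · rw [hρρ']; exact hσ.1 _
  · rintro i' r' ⟨p', m, hm, hn⟩
    obtain ⟨rfl, rfl, rfl, rfl⟩ := hreqρ' hm
    exact hn d (Nat.zero_le _) _ hans.2.1
  · intro i' r' p'
    constructor
    · rintro ⟨m, hm⟩
      obtain ⟨rfl, rfl, rfl, rfl⟩ := hreqρ' hm
      exact ⟨j, by simp⟩
    · rintro ⟨j', hj⟩
      simp only [List.mem_singleton, Prod.mk.injEq] at hj
      obtain ⟨rfl, rfl, rfl, rfl⟩ := hj
      obtain ⟨q, hq⟩ := hans.1
      obtain ⟨-, -, -, rfl⟩ := hreqρ' hq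
      exact ⟨0, hq⟩
  · intro i' r' a
    constructor
    · rintro ⟨m, n, hm⟩
      obtain ⟨q, hq⟩ := hm.1
      obtain ⟨rfl, rfl, rfl, rfl⟩ := hreqρ' hq
      exact ⟨q, j, List.mem_singleton.2 rfl, (hm.unique hans).2⟩
    · rintro ⟨p', j', hj, rfl⟩
      simp only [List.mem_singleton, Prod.mk.injEq] at hj
      obtain ⟨rfl, rfl, rfl, rfl⟩ := hj
      exact ⟨0, d, hans⟩

/-- Without concurrent write-conflicting transactions, `Tᵢ` can read and write `x` and commit. -/
theorem exists_update [Finite P] (hOFU : S.OFU) (hWFQ : S.WFQ) (hρ : S.IsExecution ρ)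
    (hL : Log ρ L) {i : Tx} {p : P} {x : Obj} (v : Val)
    (hi : ∀ e ∈ L, e.1 = i → e.2.1 = p ∧ e.2.2.1 ≠ Request.commit ∧ e.2.2.1 ≠ Request.read x ∧
      ∀ y w, e.2.2.1 ≠ Request.write y w)
    (hc : ∀ j, (toTrace ρ).Writes j x → (toTrace ρ).Precedes j i) :
    ∃ ρ' j₁ j₂ j₃, S.IsExecution (ρ ++ ρ') ∧
      Log ρ' [(i, p, Request.read x, j₁), (i, p, Request.write x v, j₂),
        (i, p, Request.commit, j₃)] := by
  have hnw : ∀ y, ¬ (toTrace ρ).Writes i y := by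
    intro y hy
    obtain ⟨e, he, hei, w, hw⟩ := hL.writes_iff.1 hy
    exact (hi e he hei).2.2.2 y w hw
  obtain ⟨ρ₁, j₁, h₁, hL₁⟩ := exists_call hOFU hWFQ hρ (i := i) (p := p) (r := Request.read x)
    (hL.allowed_iff.2 ⟨fun e he hei => ⟨(hi e he hei).1, (hi e he hei).2.1⟩,
      fun e he hei => (hi e he hei).2.2.1⟩) (by
      rintro j y - (h | ⟨v, h⟩)
      · exact (hnw y h).elim
      · cases h)
  have hLL₁ := hL.append hL₁
  have hw₁ : ∀ j y, (toTrace (ρ ++ ρ₁)).Writes j y → (toTrace ρ).Writes j y := by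
    intro j y hw
    obtain ⟨e, he, hej, w, hw⟩ := hLL₁.writes_iff.1 hw
    rw [List.mem_append, List.mem_singleton] at he
    obtain he | rfl := he
    · exact hL.writes_iff.2 ⟨e, he, hej, w, hw⟩
    · cases hw
  obtain ⟨ρ₂, j₂, h₂, hL₂⟩ := exists_call hOFU hWFQ h₁ (i := i) (p := p) (r := Request.write x v)
    (hLL₁.allowed_iff.2 ⟨fun e he hei => by
      rw [List.mem_append, List.mem_singleton] at he
      obtain he | rfl := he
      · exact ⟨(hi e he hei).1, (hi e he hei).2.1⟩
      · exact ⟨rfl, nofun⟩, ⟨_, List.mem_append_right _ (List.mem_singleton.2 rfl), rfl, rfl⟩,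
      fun e he hei w => by
      rw [List.mem_append, List.mem_singleton] at he
      obtain he | rfl := he
      · exact (hi e he hei).2.2.2 x w
      · exact nofun⟩) (by
      rintro j y - h hj
      have hy : y = x := by
        obtain h | ⟨v, h⟩ := h
        · exact (hnw y (hw₁ i y h)).elim
        · cases h; rfl
      subst hy
      exact (hc j (hw₁ j y hj)).append)
  have hLL₂ := hLL₁.append hL₂
  have hw₂ : ∀ j y, (toTrace (ρ ++ ρ₁ ++ ρ₂)).Writes j y →
      (toTrace ρ).Writes j y ∨ (j = i ∧ y = x) := by
    intro j y hw
    obtain ⟨e, he, hej, w, hw⟩ := hLL₂.writes_iff.1 hw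
    rw [List.mem_append, List.mem_singleton] at he
    obtain he | rfl := he
    · exact Or.inl (hw₁ j y (hLL₁.writes_iff.2 ⟨e, he, hej, w, hw⟩))
    · cases hw; exact Or.inr ⟨hej.symm, rfl⟩
  obtain ⟨ρ₃, j₃, h₃, hL₃⟩ := exists_call hOFU hWFQ h₂ (i := i) (p := p) (r := Request.commit)
    (hLL₂.allowed_iff.2 ⟨fun e he hei => by
      rw [List.mem_append, List.mem_append, List.mem_singleton, List.mem_singleton] at he
      obtain (he | rfl) | rfl := he
      · exact ⟨(hi e he hei).1, (hi e he hei).2.1⟩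
      · exact ⟨rfl, nofun⟩
      · exact ⟨rfl, nofun⟩, trivial⟩) (by
      rintro j y hji h hj
      have hj' : (toTrace ρ).Writes j y := (hw₂ j y hj).resolve_right fun h => hji h.1
      have hy : y = x := by
        obtain h | ⟨v, h⟩ := h
        · exact ((hw₂ i y h).resolve_left (hnw y)).2
        · cases h
      subst hy
      exact (hc j hj').append.append)
  refine ⟨ρ₁ ++ ρ₂ ++ ρ₃, j₁, j₂, j₃, ?_, (hL₁.append hL₂).append hL₃⟩
  simpa only [List.append_assoc] using h₃

/-- If all transactions are committed and access objects replicated in `R` only, through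
coordinators in `R`, then all processes outside `R` are silent. -/
theorem GPR.proc_mem (h : S.GPR replicas) (hρ : S.IsExecution ρ) (hL : Log ρ L) {R : Set P}
    (hc : ∀ e ∈ L, ∃ e' ∈ L, e'.1 = e.1 ∧ e'.2.2.1 = Request.commit)
    (hR : ∀ e ∈ L, e.2.1 ∈ R ∧ ∀ x, (e.2.2.1 = Request.read x ∨ ∃ v, e.2.2.1 = Request.write x v) →
      replicas x ⊆ R) :
    ∀ s ∈ ρ, ¬ s.Silent → s.proc ∈ R := by
  intro s hs hsil
  obtain ⟨i, -, ⟨x, hx, hp⟩ | ⟨r, m, hm⟩⟩ := h ρ hρ (by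
    rintro i ⟨r, p, m, hm⟩
    obtain ⟨j, hj⟩ := (hL.requested i r p).1 ⟨m, hm⟩
    obtain ⟨⟨i', p', r', j'⟩, he, rfl, rfl⟩ := hc _ hj
    exact hL.terminated he) s hs hsil
  · obtain ⟨p, hm⟩ | hw := hx
    · obtain ⟨j, hj⟩ := (hL.requested i _ p).1 hm
      exact (hR _ hj).2 x (Or.inl rfl) hp
    · obtain ⟨e, he, -, hv⟩ := hL.writes_iff.1 hw
      exact (hR _ he).2 x (Or.inr hv) hp
  · obtain ⟨j, hj⟩ := (hL.requested i r _).1 ⟨m, hm⟩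
    exact (hR _ hj).1

end Protocol

/-! ### Operations of an execution -/

section Operations

variable {ρ : List (Step P Obj Tx Val State Msg)} {L : List (Tx × P × Request Obj Val × Option Tx)}
  {x : Obj} {j k : Option Tx}

theorem write_mem_ops :
    Operation.write k x ∈ (toTrace ρ).ops ↔
      k = none ∨ ∃ t v j, k = some t ∧ (toTrace ρ).Done t (Request.write x v) (Reply.ok j) := by
  rw [mem_ops_iff]
  constructor
  · rintro (⟨y, h⟩ | h | ⟨i, r, a, hd, h⟩)
    · cases h; exact Or.inl rfl
    · cases h
    · cases r <;> cases a <;> cases h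
      exact Or.inr ⟨i, _, _, rfl, hd⟩
  · rintro (rfl | ⟨t, v, j, rfl, h⟩)
    · exact Or.inl ⟨x, rfl⟩
    · exact Or.inr (Or.inr ⟨t, _, _, h, rfl⟩)

theorem read_mem_ops :
    Operation.read k x j ∈ (toTrace ρ).ops ↔
      ∃ t, k = some t ∧ (toTrace ρ).Done t (Request.read x) (Reply.ok j) := by
  rw [mem_ops_iff]
  constructor
  · rintro (⟨y, h⟩ | h | ⟨i, r, a, hd, h⟩)
    · cases h
    · cases h
    · cases r <;> cases a <;> cases h
      exact ⟨i, rfl, hd⟩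
  · rintro ⟨t, rfl, h⟩
    exact Or.inr (Or.inr ⟨t, _, _, h, rfl⟩)

theorem commit_mem_ops :
    Operation.commit k ∈ (toTrace ρ).ops ↔
      k = none ∨ ∃ t j, k = some t ∧ (toTrace ρ).Done t Request.commit (Reply.ok j) := by
  rw [mem_ops_iff]
  constructor
  · rintro (⟨y, h⟩ | h | ⟨i, r, a, hd, h⟩)
    · cases h
    · cases h; exact Or.inl rfl
    · cases r <;> cases a <;> cases h
      exact Or.inr ⟨i, _, rfl, hd⟩
  · rintro (rfl | ⟨t, j, rfl, h⟩)
    · exact Or.inr (Or.inl rfl)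
    · exact Or.inr (Or.inr ⟨t, _, _, h, rfl⟩)

theorem Log.done_of_mem (h : Log ρ L) {i : Tx} {p : P} {r : Request Obj Val}
    (he : (i, p, r, j) ∈ L) : (toTrace ρ).Done i r (Reply.ok j) :=
  (h.done _ _ _).2 ⟨p, j, he, rfl⟩

/-- Serves to refute dependencies: a set of transactions closed under reads-from contains everything
on which its members depend. -/
theorem History.Depends.mem_of_closed {h : History Obj Tx} {Q : Set (Option Tx)}
    (hQ : ∀ i x j, i ∈ Q → Operation.read i x j ∈ h.ops → j ∈ Q) (hd : h.Depends j k)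
    (hj : j ∈ Q) : k ∈ Q := by
  unfold History.Depends at hd
  induction hd with
  | single h => obtain ⟨x, h⟩ := h; exact hQ _ x _ hj h
  | tail _ h ih => obtain ⟨x, h⟩ := h; exact hQ _ x _ ih h

end Operations

/-! ### Reads and their writers, the forbidden pattern, and the two blocks. -/

namespace Protocol

variable {S : Protocol P Obj Tx Val State Msg}
  {F : List (Step P Obj Tx Val State Msg) → History Obj Tx} {replicas : Obj → Set P}
  {ρ α β : List (Step P Obj Tx Val State Msg)} {L : List (Tx × P × Request Obj Val × Option Tx)}

theorem IsRefinement.write_mem_ops (hF : S.IsRefinement F) (hρ : S.IsExecution ρ)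
    {i j : Option Tx} {x : Obj} (h : Operation.read i x j ∈ (toTrace ρ).ops) :
    Operation.write j x ∈ (toTrace ρ).ops := by
  obtain ⟨hh, ho, -⟩ := hF ρ hρ
  rw [← ho] at h ⊢
  exact (hh.mem_of_lt _ _ (hh.reads_from _ _ _ h)).1

/-- The history orders the write of a version before its read, so that write belongs to the initial
transaction or to the log. A version written by the reader itself is not excluded here. -/
theorem IsRefinement.read_version (hF : S.IsRefinement F) (hρ : S.IsExecution ρ)
    (hL : Log ρ L) {i : Tx} {p : P} {x : Obj} {j : Option Tx}
    (h : (i, p, Request.read x, j) ∈ L) :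
    j = none ∨ ∃ t, j = some t ∧ ∃ q v k, (t, q, Request.write x v, k) ∈ L := by
  have h := PartialReplication.write_mem_ops.1
    (hF.write_mem_ops hρ (read_mem_ops.2 ⟨i, rfl, hL.done_of_mem h⟩))
  obtain h | ⟨t, v, k, h, hd⟩ := h
  · exact Or.inl h
  · obtain ⟨q, k, he, -⟩ := (hL.done _ _ _).1 hd
    exact Or.inr ⟨t, h, q, v, k, he⟩

/-- A client issues only requests that are allowed. -/
theorem IsExecution.allowed {γ : List (Step P Obj Tx Val State Msg)}
    (h : S.IsExecution (ρ ++ γ)) {i : Tx} {r : Request Obj Val} {p : P}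
    {m : ℕ} (hm : (toTrace γ).RequestAt i r p m) :
    (toTrace (ρ ++ γ.take m)).Allowed i p r := by
  obtain ⟨c, h⟩ := h
  obtain ⟨s, hs, rfl, hi⟩ := hm
  obtain ⟨hlt, rfl⟩ := List.getElem?_eq_some_iff.1 hs
  rw [← List.take_append_drop (m + 1) γ, ← List.append_assoc] at h
  obtain ⟨c', h⟩ := h.prefix
  rw [← List.take_concat_get' γ m hlt, ← List.append_assoc] at h
  obtain ⟨-, -, -, h⟩ := reaches_snoc_iff.1 h
  exact h i r hi

/-- A client reads an object at most once. When the only requests of a transaction in `γ` are reads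
of `x`, this leaves a single request to account for. -/
theorem IsExecution.read_unique {γ : List (Step P Obj Tx Val State Msg)}
    (h : S.IsExecution (ρ ++ γ)) {i : Tx} {x : Obj} {p p' : P} {m m' : ℕ}
    (hm : (toTrace γ).RequestAt i (Request.read x : Request Obj Val) p m)
    (hm' : (toTrace γ).RequestAt i (Request.read x : Request Obj Val) p' m') : m = m' := by
  have key : ∀ {p p' : P} {m m' : ℕ},
      (toTrace γ).RequestAt i (Request.read x : Request Obj Val) p m →
      (toTrace γ).RequestAt i (Request.read x : Request Obj Val) p' m' → ¬ m < m' := by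
    intro p p' m m' hm hm' hlt
    have ha := (allowed_iff.1 (h.allowed hm')).2.2.2
    refine ha p (requested_append.2 (Or.inr ⟨m, ?_⟩))
    have hl : m < (γ.take m').length := by
      rw [List.length_take]; exact lt_min hlt (requestAt_lt hm)
    rw [← List.take_append_drop m' γ] at hm
    exact (requestAt_append_of_lt hl).1 hm
  exact le_antisymm (not_lt.1 (key hm' hm)) (not_lt.1 (key hm hm'))

/-- `T_a` reads the initial version of `x` although `T_k` overwrites it and commits before `T_l`,
from which `T_a` reads. -/
theorem IsRefinement.not_implements_SCONSb (hF : S.IsRefinement F) (hρ : S.IsExecution ρ)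
    {a k : Tx} {l : Option Tx} {x y : Obj} {v : Val} {j j₁ j₂ : Option Tx}
    (hx : (toTrace ρ).Done a (Request.read x) (Reply.ok none))
    (hy : (toTrace ρ).Done a (Request.read y) (Reply.ok l))
    (ha : (toTrace ρ).Done a Request.commit (Reply.ok j))
    (hw : (toTrace ρ).Done k (Request.write x v) (Reply.ok j₁))
    (hk : (toTrace ρ).Done k Request.commit (Reply.ok j₂))
    (hkl : (toTrace ρ).RealTime (Operation.commit (some k)) (Operation.commit l)) :
    ¬ S.Implements F History.SCONSb := by
  intro hS
  obtain ⟨hh, ho, hrt⟩ := hF ρ hρ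
  have hlt := hrt _ _ hkl
  have h := hS ρ hρ (some a) none (some k) l x y nofun
    (ho ▸ commit_mem_ops.2 (Or.inr ⟨a, j, rfl, ha⟩)) (ho ▸ commit_mem_ops.2 (Or.inl rfl))
    (hh.mem_of_lt _ _ hlt).1 (hh.mem_of_lt _ _ hlt).2
    (ho ▸ read_mem_ops.2 ⟨a, rfl, hx⟩) (ho ▸ read_mem_ops.2 ⟨a, rfl, hy⟩)
    (ho ▸ PartialReplication.write_mem_ops.2 (Or.inr ⟨k, v, j₁, rfl, hw⟩)) hlt
  obtain ⟨m, n, hmn⟩ := hk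
  -- SCONS-b has put the commit of `T_k` before that of the initial transaction, which in real time
  -- precedes everything that clients do.
  exact hh.irrefl _ (hh.trans _ _ _ h (hrt _ _ (.init_commit k _ _ m n hmn)))

/-- An update transaction that runs alone can be executed by the replicas of its object. -/
theorem exists_update_block [Finite P] (hGPR : S.GPR replicas) (hOFU : S.OFU) (hWFQ : S.WFQ)
    {q : P} {y : Obj} (hq : q ∈ replicas y) (t : Tx) (v : Val) :
    ∃ α c j₁ j₂ j₃, S.Reaches α c ∧ (∀ s ∈ α, s.proc ∈ replicas y) ∧
      Log α [(t, q, Request.read y, j₁), (t, q, Request.write y v, j₂),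
        (t, q, Request.commit, j₃)] := by
  classical
  obtain ⟨α, j₁, j₂, j₃, hα, hL⟩ := exists_update hOFU hWFQ (ρ := []) ⟨_, .nil⟩ Log.nil
    (i := t) (p := q) (x := y) v (by simp) (by
      intro j hj
      obtain ⟨e, he, -⟩ := Log.nil.writes_iff.1 hj
      simp at he)
  rw [List.nil_append] at hα
  have hsil := hGPR.proc_mem hα hL (R := replicas y) (by simp) (by simp [hq])
  obtain ⟨c, hc⟩ := hα
  obtain ⟨he, c', hc', -⟩ := hc.filter hsil
  exact ⟨_, c', j₁, j₂, j₃, hc', fun s hs => by simpa using (List.mem_filter.1 hs).2,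
    hL.clientEquiv he⟩

/-- `T_a` reads `x`, then `T_t` updates `x`, and only replicas of `x` make steps. -/
theorem exists_read_update_block [Finite P] (hF : S.IsRefinement F) (hGPR : S.GPR replicas)
    (hOFU : S.OFU) (hWFQ : S.WFQ) {p : P} {x : Obj} (hp : p ∈ replicas x) {a t : Tx} (hat : a ≠ t)
    (v : Val) :
    ∃ β c j₁ j₂ j₃, S.Reaches β c ∧ (∀ s ∈ β, s.proc ∈ replicas x) ∧
      Log β [(a, p, Request.read x, none), (t, p, Request.read x, j₁),
        (t, p, Request.write x v, j₂), (t, p, Request.commit, j₃)] := by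
  classical
  obtain ⟨β₁, j, h₁, hL₁⟩ := exists_call hOFU hWFQ (ρ := []) ⟨_, .nil⟩ (i := a) (p := p)
    (r := Request.read x) (Log.nil.allowed_iff.2 (by simp)) (by
      intro j x _ _ hj
      obtain ⟨e, he, -⟩ := Log.nil.writes_iff.1 hj
      simp at he)
  rw [List.nil_append] at h₁
  obtain rfl : j = none := by
    obtain h | ⟨t, rfl, h⟩ := hF.read_version h₁ hL₁ (List.mem_singleton.2 rfl)
    · exact h
    · simp at h
  obtain ⟨β₂, j₁, j₂, j₃, h₂, hL₂⟩ := exists_update hOFU hWFQ h₁ hL₁ (i := t) (p := p) (x := x) v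
    (by simp [hat]) (by
      intro j hj
      obtain ⟨e, he, -, w, hw⟩ := hL₁.writes_iff.1 hj
      obtain rfl := List.mem_singleton.1 he
      cases hw)
  have hL := hL₁.append hL₂
  -- Genuineness speaks only of executions whose transactions have all terminated. So `T_a` is made
  -- to commit, the attribution of steps is read off from the longer execution, and this commit is
  -- then dropped.
  obtain ⟨β₃, j₄, h₃, hL₃⟩ := exists_call hOFU hWFQ h₂ (i := a) (p := p) (r := Request.commit)
    (hL.allowed_iff.2 (by simp [hat.symm])) (by
      rintro j y hj (h | ⟨w, h⟩) -
      · obtain ⟨e, he, hei, w, hw⟩ := hL.writes_iff.1 h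
        simp only [List.cons_append, List.nil_append, List.mem_cons, List.not_mem_nil,
          or_false] at he
        obtain rfl | rfl | rfl | rfl := he
        · cases hw
        all_goals exact absurd hei hat.symm
      · cases h)
  have hsil := hGPR.proc_mem h₃ (hL.append hL₃) (R := replicas x) (by simp) (by simp [hp])
  obtain ⟨c, hc⟩ := h₂
  obtain ⟨he, c', hc', -⟩ := hc.filter fun s hs => hsil s (List.mem_append_left _ hs)
  exact ⟨_, c', j₁, j₂, j₃, hc', fun s hs => by simpa using (List.mem_filter.1 hs).2,
    hL.clientEquiv he⟩

end Protocol

/-- A history in which `T₀`, then `T_b`, which updates `y`, precede all operations of `T_a`, which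
reads `x`, and `T_t`, which updates `x`, remains in SI when `T_a` reads the version of `y` written
by `T_b`. -/
theorem History.SI_append_read {h : History Obj Tx} (hh : h.IsHistory) {x y : Obj} (hxy : x ≠ y)
    {a b t : Tx} (hab : a ≠ b) (htb : t ≠ b) {j k : Option Tx}
    (hj : j = none ∨ j = some b) (hk : k = none ∨ k = some t)
    (hops : ∀ o, o ∈ h.ops ↔ (∃ z, o = .write none z) ∨ o = .commit none ∨
      (o = .read (some b) y j ∨ o = .write (some b) y ∨ o = .commit (some b)) ∨
      o = .read (some a) x none ∨ o = .read (some t) x k ∨ o = .write (some t) x ∨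
      o = .commit (some t))
    (h0 : ∀ o o', o ∈ h.ops → o' ∈ h.ops → o.tx = none → o'.tx ≠ none → h.lt o o')
    (hb : ∀ o o', o ∈ h.ops → o' ∈ h.ops → o.tx = some b → o'.tx ≠ none → o'.tx ≠ some b →
      h.lt o o') :
    (h.append (.read (some a) y (some b))).SI := by
  classical
  set new : Operation Obj Tx := .read (some a) y (some b) with hnew
  have hnot : new ∉ h.ops := by
    rw [hops]; simp [hnew, hxy.symm, hab]
  -- Three layers: the initial transaction, then `T_b`, then `T_a` and `T_t`. The order of the
  -- history never goes down in rank.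
  let rank : Option Tx → ℕ := fun i => if i = none then 0 else if i = some b then 1 else 2
  have r0 : rank none = 0 := rfl
  have rb : rank (some b) = 1 := by simp [rank]
  have ra : rank (some a) = 2 := by simp [rank, hab]
  have rt : rank (some t) = 2 := by simp [rank, htb]
  have rle : ∀ i, rank i ≤ 2 := by intro i; simp only [rank]; split_ifs <;> omega
  have rpos : ∀ i, i ≠ none → 1 ≤ rank i := by
    intro i hi; simp only [rank, hi, if_false]; split_ifs <;> omega
  have rlt : ∀ o o', o ∈ h.ops → o' ∈ h.ops → rank o.tx < rank o'.tx → h.lt o o' := by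
    intro o o' ho ho' hlt
    have ho'n : o'.tx ≠ none := by intro he; rw [he, r0] at hlt; omega
    by_cases hon : o.tx = none
    · exact h0 o o' ho ho' hon ho'n
    · have hob : o.tx = some b := by
        by_contra hob
        have : rank o.tx = 2 := by simp [rank, hon, hob]
        have := rle o'.tx
        omega
      refine hb o o' ho ho' hob ho'n fun he => ?_
      rw [hob, he] at hlt; omega
  let lt' := (h.append new).lt
  have lt'_irrefl : ∀ o, ¬ lt' o o := by
    rintro o (ho | ⟨ho, rfl⟩)
    · exact hh.irrefl o ho
    · exact hnot ho
  have lt'_trans : ∀ o₁ o₂ o₃, lt' o₁ o₂ → lt' o₂ o₃ → lt' o₁ o₃ := by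
    rintro o₁ o₂ o₃ (h₁ | ⟨h₁, rfl⟩) (h₂ | ⟨h₂, rfl⟩)
    · exact Or.inl (hh.trans _ _ _ h₁ h₂)
    · exact Or.inr ⟨(hh.mem_of_lt _ _ h₁).1, rfl⟩
    · exact (hnot (hh.mem_of_lt _ _ h₂).1).elim
    · exact (hnot h₂).elim
  have lt'_rank : ∀ o o', lt' o o' → rank o.tx ≤ rank o'.tx := by
    rintro o o' (ho | ⟨ho, rfl⟩)
    · by_contra hlt
      obtain ⟨h₁, h₂⟩ := hh.mem_of_lt _ _ ho
      exact hh.irrefl _ (hh.trans _ _ _ ho (rlt _ _ h₂ h₁ (not_le.1 hlt)))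
    · have : rank new.tx = 2 := ra
      rw [this]; exact rle _
  -- Within each layer, all snapshot points (even stages) come before all operations (odd stages).
  -- Operations of the same layer keep the order of the history.
  let stage : Operation Obj Tx ⊕ Option Tx → ℕ :=
    Sum.elim (fun o => 2 * rank o.tx + 1) (fun i => 2 * rank i)
  have hwr : ∀ i z, Operation.write i z ∈ (h.append new).ops → i = none ∨
      (i = some b ∧ z = y) ∨ (i = some t ∧ z = x) := by
    rintro i z (hw | hw)
    · cases hw.trans hnew
    · rw [hops] at hw
      simpa using hw
  have hrd : ∀ i z l, Operation.read i z l ∈ (h.append new).ops →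
      (i = some a ∧ z = y ∧ l = some b) ∨ (i = some b ∧ z = y ∧ l = j) ∨
        (i = some a ∧ z = x ∧ l = none) ∨ (i = some t ∧ z = x ∧ l = k) := by
    rintro i z l (hr | hr)
    · cases hr.trans hnew; exact Or.inl ⟨rfl, rfl, rfl⟩
    · rw [hops] at hr
      exact Or.inr (by simpa using hr)
  have hc0 : Operation.commit none ∈ (h.append new).ops := Or.inr ((hops _).2 (by simp))
  have hcb : Operation.commit (some b) ∈ (h.append new).ops := Or.inr ((hops _).2 (by simp))
  refine ⟨fun u w => stage u < stage w ∨
    ∃ o o', u = Sum.inl o ∧ w = Sum.inl o' ∧ rank o.tx = rank o'.tx ∧ lt' o o', ?_, ?_, ?_, ?_, ?_,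
    ?_⟩
  · rintro u (hlt | ⟨o, o', rfl, he, -, hlt⟩)
    · exact lt_irrefl _ hlt
    · cases he; exact lt'_irrefl _ hlt
  · rintro u v w (h₁ | ⟨o₁, o₂, rfl, rfl, e₁, h₁⟩) (h₂ | ⟨o₃, o₄, he, rfl, e₂, h₂⟩)
    · exact Or.inl (h₁.trans h₂)
    · subst he
      left
      simp only [stage, Sum.elim_inl] at h₁ ⊢
      omega
    · left
      simp only [stage, Sum.elim_inl] at h₂ ⊢
      omega
    · cases he
      exact Or.inr ⟨_, _, rfl, rfl, e₁.trans e₂, lt'_trans _ _ _ h₁ h₂⟩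
  · intro o o' hlt
    obtain hr | hr := (lt'_rank o o' hlt).lt_or_eq
    · left; simp only [stage, Sum.elim_inl]; omega
    · exact Or.inr ⟨o, o', rfl, rfl, hr, hlt⟩
  · intro o _
    left
    simp only [stage, Sum.elim_inl, Sum.elim_inr]
    omega
  · intro i l m z hli hml hr hw _
    obtain ⟨rfl, rfl, rfl⟩ | hr' := hrd i z l hr
    -- For the appended read of `y`, the only competing writer is the initial transaction, which
    -- commits before `T_b`.
    · obtain rfl : m = none := by
        obtain hm | ⟨hm, -⟩ | ⟨-, hm⟩ := hwr m z hw
        · exact hm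
        · exact (hml hm).elim
        · exact (hxy hm.symm).elim
      refine ⟨hcb, Or.inl ?_, Or.inl (Or.inl ?_)⟩ <;>
        simp only [stage, Sum.elim_inl, Sum.elim_inr, Operation.tx, r0, ra, rb] <;> omega
    -- Every other read that is not of the reader's own version returns the initial version. A
    -- competing writer other than the initial transaction has at least the rank of the reader,
    -- hence commits after the reader's snapshot point.
    · have key : i ≠ none ∧ l = none ∧ (m ≠ none → rank i ≤ rank m) := by
        obtain ⟨rfl, rfl, rfl⟩ | ⟨rfl, rfl, rfl⟩ | ⟨rfl, rfl, rfl⟩ := hr'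
        · refine ⟨nofun, hj.resolve_right hli, fun hm => ?_⟩
          rw [rb]; exact rpos m hm
        · refine ⟨nofun, rfl, fun hm => ?_⟩
          obtain hm' | ⟨-, hm'⟩ | ⟨rfl, -⟩ := hwr m z hw
          · exact (hm hm').elim
          · exact (hxy hm').elim
          · rw [ra, rt]
        · refine ⟨nofun, hk.resolve_right hli, fun hm => ?_⟩
          obtain hm' | ⟨-, hm'⟩ | ⟨rfl, -⟩ := hwr m z hw
          · exact (hm hm').elim
          · exact (hxy hm').elim
          · exact le_rfl
      obtain ⟨hi, rfl, hm⟩ := key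
      have h₁ := rpos i hi
      have h₂ := hm hml
      refine ⟨hc0, Or.inl ?_, Or.inr (Or.inl ?_)⟩ <;>
        simp only [stage, Sum.elim_inl, Sum.elim_inr, Operation.tx, r0] <;> omega
  · intro i l z hil _ _ hwi hwl
    have key : ∀ i l : Option Tx, i = none → l ≠ none →
        stage (Sum.inl (Operation.commit i)) < stage (Sum.inr l) := by
      rintro i l rfl hl
      have := rpos l hl
      simp only [stage, Sum.elim_inl, Sum.elim_inr, Operation.tx, r0]
      omega
    by_cases hi : i = none
    · exact Or.inl (Or.inl (key i l hi fun hl => hil (hi.trans hl.symm)))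
    · by_cases hl : l = none
      · exact Or.inr (Or.inl (key l i hl hi))
      -- Apart from the initial transaction, only `T_b` writes `y` and only `T_t` writes `x`.
      · exfalso
        obtain hi' | ⟨rfl, rfl⟩ | ⟨rfl, rfl⟩ := hwr i z hwi
        · exact hi hi'
        · obtain hl' | ⟨rfl, -⟩ | ⟨-, hl'⟩ := hwr l _ hwl
          exacts [hl hl', hil rfl, hxy hl'.symm]
        · obtain hl' | ⟨-, hl'⟩ | ⟨rfl, -⟩ := hwr l _ hwl
          exacts [hl hl', hxy hl', hil rfl]

/-! ### The violation under WCF, and under ACA with positive freshness. -/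

namespace Protocol

variable {S : Protocol P Obj Tx Val State Msg}
  {F : List (Step P Obj Tx Val State Msg) → History Obj Tx}
  {α β : List (Step P Obj Tx Val State Msg)} {c : Config P State Msg} {p q : P} {x y : Obj} {v : Val}
  {a b t : Tx} {j₁ j₂ j₃ k₁ k₂ k₃ : Option Tx}

/-- With WCF, `T_a` can be made to read the version of `y` written by `T_b`. -/
theorem not_implements_SCONSb_of_WCF [Finite P] (hF : S.IsRefinement F) (hOFU : S.OFU)
    (hWFQ : S.WFQ) (hW : S.Implements F History.WCF) (hxy : x ≠ y) (hab : a ≠ b) (hat : a ≠ t)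
    (htb : t ≠ b)
    (hα : Log α [(b, q, Request.read y, j₁), (b, q, Request.write y v, j₂),
      (b, q, Request.commit, j₃)])
    (hβ : Log β [(a, p, Request.read x, none), (t, p, Request.read x, k₁),
        (t, p, Request.write x v, k₂), (t, p, Request.commit, k₃)])
    (h₁ : S.Reaches (α ++ β) c) (h₂ : S.Reaches (β ++ α) c) :
    ¬ S.Implements F History.SCONSb := by
  have hαβ := hα.append hβ
  -- `T_a` is turned into an update of `y`, so that WCF applies to it and `T_b`.
  obtain ⟨γ, l₁, l₂, l₃, hex, hγ⟩ := exists_update hOFU hWFQ ⟨c, h₁⟩ hαβ (i := a) (p := p)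
    (x := y) v (by simp [hab.symm, hat.symm, hxy]) (by
      intro j hj
      obtain ⟨e, he, rfl, w, hw⟩ := hαβ.writes_iff.1 hj
      have heb : e.1 = b := by
        simp only [List.cons_append, List.nil_append, List.mem_cons, List.not_mem_nil,
          or_false] at he
        obtain rfl | rfl | rfl | rfl | rfl | rfl | rfl := he <;> simp_all
      rw [heb]
      -- Here the order of the blocks matters: `T_b` terminates in `α`, before `T_a` starts in `β`,
      -- so OFU lets `T_a` succeed.
      refine precedes_append (hα.terminated (p := q) (k := j₃) (by simp)) fun r p' => ?_
      rw [hα.requested]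
      simp [hab])
  have hA := hαβ.append hγ
  obtain ⟨-, ho, -⟩ := hF _ hex
  have hl₁ : l₁ = none ∨ l₁ = some b ∨ l₁ = some a := by
    obtain h | ⟨u, rfl, q', w, k, h⟩ := hF.read_version hex hA (i := a) (p := p) (x := y) (j := l₁)
      (by simp)
    · exact Or.inl h
    · right
      simp only [List.cons_append, List.nil_append, List.mem_cons, List.not_mem_nil,
          or_false, Prod.mk.injEq, Request.write.injEq, reduceCtorEq, and_false, false_and,
          false_or, hxy.symm] at h
      obtain ⟨rfl, -⟩ | ⟨rfl, -⟩ := h <;> simp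
  have hj₁ : j₁ = none ∨ j₁ = some b := by
    obtain h | ⟨u, rfl, q', w, k, h⟩ := hF.read_version (h₁.prefix.imp fun _ h => h) hα
      (i := b) (p := q) (x := y) (j := j₁) (by simp)
    · exact Or.inl h
    · right
      simp only [List.mem_cons, List.not_mem_nil,
          or_false, Prod.mk.injEq, Request.write.injEq, reduceCtorEq, and_false, false_and,
          false_or] at h
      rw [h.1]
  have hread : ∀ i z j, Operation.read i z j ∈ (F (α ++ β ++ γ)).ops →
      (i = some b ∧ j = j₁) ∨ (i = some a ∧ (j = none ∨ j = l₁)) ∨ i = some t := by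
    intro i z j h
    rw [ho, hA.mem_ops] at h
    simp [opOf] at h
    tauto
  -- The set of the initial transaction and `T_b` is closed under reads-from. If `T_a` did not read
  -- from `T_b`, the same would hold for the initial transaction and `T_a`, and neither of `T_a` and
  -- `T_b` would depend on the other.
  obtain rfl : l₁ = some b := by
    by_contra hne
    have hl₁' : l₁ = none ∨ l₁ = some a := by tauto
    have hcomm : ∀ u ∈ [a, b], Operation.commit (some u) ∈ (F (α ++ β ++ γ)).ops := by
      intro u hu
      rw [ho, hA.mem_ops]
      simp at hu
      obtain rfl | rfl := hu <;> simp [opOf]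
    have hwrite : ∀ u ∈ [a, b], Operation.write (some u) y ∈ (F (α ++ β ++ γ)).ops := by
      intro u hu
      rw [ho, hA.mem_ops]
      simp at hu
      obtain rfl | rfl := hu <;> simp [opOf]
    obtain h | h := hW _ hex (some a) (some b) y (by simpa using hab) (hcomm a (by simp))
      (hcomm b (by simp)) (hwrite a (by simp)) (hwrite b (by simp))
    · have := h.mem_of_closed (Q := {none, some a}) (by
        rintro i z j (rfl | rfl) hr
        · simpa using hread _ _ _ hr
        · obtain ⟨h, -⟩ | ⟨-, rfl | rfl⟩ | h := hread _ _ _ hr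
          · cases h; exact (hab rfl).elim
          · simp
          · simpa using hl₁'
          · cases h; exact (hat rfl).elim) (by simp)
      simp [hab.symm] at this
    · have := h.mem_of_closed (Q := {none, some b}) (by
        rintro i z j (rfl | rfl) hr
        · simpa using hread _ _ _ hr
        · obtain ⟨-, rfl⟩ | ⟨h, -⟩ | h := hread _ _ _ hr
          · simpa using hj₁
          · cases h; exact (hab rfl).elim
          · cases h; exact (htb rfl).elim) (by simp)
      simp [hab] at this
  have hB := (hβ.append hα).append hγ
  obtain ⟨d, hd⟩ := hex
  -- The continuation is moved behind the swapped blocks, where `T_t` commits before `T_b` starts.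
  have hBex := h₁.transfer h₂ (hα.clientEquiv_append_comm hβ) hd
  refine hF.not_implements_SCONSb ⟨d, hBex⟩ (a := a) (k := t) (l := some b) (x := x) (y := y)
    (v := v) (j := l₃) (j₁ := k₂) (j₂ := k₃) (hB.done_of_mem (p := p) (by simp))
    (hB.done_of_mem (p := p) (by simp)) (hB.done_of_mem (p := p) (by simp))
    (hB.done_of_mem (p := p) (by simp)) (hB.done_of_mem (p := p) (by simp)) ?_
  exact ((hβ.done_of_mem (i := t) (p := p) (r := .commit) (j := k₃) (by simp)).realTime_append
    (hα.done_of_mem (i := b) (p := q) (r := .commit) (j := j₃) (by simp))).append_right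

/-- With positive-freshness acceptance, `T_a` can be made to read a version of `y` at least as
recent as the one written by `T_b`. -/
theorem not_implements_SCONSb_of_ACA [Finite P] (hF : S.IsRefinement F) (hOFU : S.OFU)
    (hWFQ : S.WFQ) (hACA : S.Implements F History.ACA) (hPF : S.PositiveFreshness F) (hxy : x ≠ y)
    (hab : a ≠ b) (hat : a ≠ t) (htb : t ≠ b)
    (hα : Log α [(b, q, Request.read y, j₁), (b, q, Request.write y v, j₂),
      (b, q, Request.commit, j₃)])
    (hβ : Log β [(a, p, Request.read x, none), (t, p, Request.read x, k₁),
        (t, p, Request.write x v, k₂), (t, p, Request.commit, k₃)])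
    (h₁ : S.Reaches (α ++ β) c) (h₂ : S.Reaches (β ++ α) c) :
    ¬ S.Implements F History.SCONSb := by
  have hαβ := hα.append hβ
  have hβα := hβ.append hα
  have hwriter : ∀ k, Operation.write k y ∈ (toTrace (α ++ β)).ops → k = none ∨ k = some b := by
    intro k hk
    rw [hαβ.mem_ops] at hk
    simpa [opOf, hxy.symm] using hk
  have hwb : Operation.write (some b) y ∈ (toTrace (α ++ β)).ops := by
    rw [hαβ.mem_ops]; simp [opOf]
  have hreqa : ∀ r p', (toTrace (α ++ β)).Requested a r p' → r = Request.read x ∧ p' = p := by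
    intro r p' h
    obtain ⟨j, hj⟩ := (hαβ.requested _ _ _).1 h
    simp [hab, hat] at hj
    exact ⟨hj.2.1, hj.1⟩
  -- Initial versions come first in the version order of every history, by real time.
  have hinit : ∀ ρ : List (Step P Obj Tx Val State Msg), S.IsExecution ρ → ∀ k z,
      Operation.write (some k) z ∈ (F ρ).ops →
      ¬ (F ρ).lt (Operation.write (some k) z) (Operation.write none z) := by
    intro ρ hρ k z hk hlt
    obtain ⟨hh, ho, hrt⟩ := hF ρ hρ
    rw [ho, PartialReplication.write_mem_ops] at hk
    obtain hk | ⟨u, w, j, hu, m, n, hd⟩ := hk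
    · cases hk
    · cases hu
      exact hh.irrefl _ (hh.trans _ _ _ hlt (hrt _ _ (.init_write z k _ _ m n hd)))
  obtain ⟨hh, ho, hrt⟩ := hF (α ++ β) ⟨c, h₁⟩
  have hops : ∀ o, o ∈ (F (α ++ β)).ops ↔ (∃ z, o = .write none z) ∨ o = .commit none ∨
      (o = .read (some b) y j₁ ∨ o = .write (some b) y ∨ o = .commit (some b)) ∨
      o = .read (some a) x none ∨ o = .read (some t) x k₁ ∨ o = .write (some t) x ∨
      o = .commit (some t) := by
    intro o
    rw [ho, hαβ.mem_ops]
    simp [opOf, or_assoc]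
  have hSI : ((F (α ++ β)).append (Operation.read (some a) y (some b))).SI := by
    refine History.SI_append_read hh hxy hab htb ?_ ?_ hops ?_ ?_
    · apply hwriter
      exact hF.write_mem_ops ⟨c, h₁⟩ (i := some b) (by rw [← ho, hops]; simp)
    · have := hF.write_mem_ops ⟨c, h₁⟩ (i := some t) (x := x) (j := k₁) (by rw [← ho, hops]; simp)
      rw [← ho, hops] at this
      simpa [hxy] using this
    · intro o o' hm hm' he he'
      rw [ho] at hm hm'
      apply hrt
      rw [mem_ops_iff] at hm hm'
      obtain ⟨z, rfl⟩ | rfl | ⟨i, r, u, ⟨m, n, hd⟩, rfl⟩ := hm'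
      · exact (he' rfl).elim
      · exact (he' rfl).elim
      obtain ⟨z, rfl⟩ | rfl | ⟨i, r, u, -, rfl⟩ := hm
      · exact .init_write _ _ _ _ _ _ hd
      · exact .init_commit _ _ _ _ _ hd
      · cases r <;> cases u <;> cases he
    · intro o o' hm hm' he hn' hb'
      apply hrt
      obtain ⟨e, hmem, rfl⟩ : ∃ e ∈ [(b, q, Request.read y, j₁), (b, q, Request.write y v, j₂),
          (b, q, Request.commit, j₃)], o = opOf e.1 e.2.2.1 (Reply.ok e.2.2.2) := by
        rw [hops] at hm
        obtain ⟨z, rfl⟩ | rfl | hm | rfl | rfl | rfl | rfl := hm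
        · cases he
        · cases he
        · simpa [opOf] using hm
        · cases he; exact (hab rfl).elim
        all_goals cases he; exact (htb rfl).elim
      obtain ⟨e', hmem', rfl⟩ : ∃ e ∈ [(a, p, Request.read x, none), (t, p, Request.read x, k₁),
          (t, p, Request.write x v, k₂), (t, p, Request.commit, k₃)],
          o' = opOf e.1 e.2.2.1 (Reply.ok e.2.2.2) := by
        rw [hops] at hm'
        obtain ⟨z, rfl⟩ | rfl | (rfl | rfl | rfl) | hm' := hm'
        · exact (hn' rfl).elim
        · exact (hn' rfl).elim
        · exact (hb' rfl).elim
        · exact (hb' rfl).elim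
        · exact (hb' rfl).elim
        · simpa [opOf] using hm'
      exact (hα.done_of_mem hmem).realTime_append (hβ.done_of_mem hmem')
  obtain ⟨γ, hex, hγreq, k, hk, hkb⟩ := hPF (α ++ β) ⟨c, h₁⟩ a p y (some b)
    (hαβ.allowed_iff.2 (by simp [hab.symm, hat.symm, hxy]))
    ⟨ho ▸ hwb, by
      obtain ⟨m, n, hd⟩ := hα.done_of_mem (i := b) (p := q) (r := .commit) (j := j₃) (by simp)
      refine ⟨n, ⟨j₃, m, answered_append_left hd⟩, fun r p' m' hm' => ?_⟩
      by_contra hle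
      have hn := replyAt_lt hd.2.1
      have := (hα.requested a r p').1
        ⟨m', (requestAt_append_of_lt (by omega)).1 hm'⟩
      simp [hab] at this, by
      intro k hk _
      obtain rfl | rfl := hwriter k (ho ▸ hk)
      · exact hinit _ ⟨c, h₁⟩ b y (ho ▸ hwb)
      · exact hh.irrefl _⟩ hSI (by
      rintro j z - ⟨w, p', m, hm⟩ -
      cases (hreqa _ _ ⟨m, hm⟩).1)
  obtain ⟨hhA, hoA, -⟩ := hF _ hex
  -- Only the requests of `T_a` are restricted in `γ`; other transactions may run there and may even
  -- write the version that `T_a` reads.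
  have hγa : ∀ r p', (toTrace γ).Requested a r p' → r = Request.read y ∧ p' = p := by
    rintro r p' ⟨m, s, hs, rfl, hi⟩
    exact hγreq s (List.mem_of_getElem? hs) r hi
  have hnw : ∀ w z p', ¬ (toTrace (α ++ β ++ γ)).Requested a (Request.write z w) p' := by
    intro w z p' h
    obtain h | h := requested_append.1 h
    · cases (hreqa _ _ h).1
    · cases (hγa _ _ h).1
  have hwk := hF.write_mem_ops hex (hoA ▸ hk)
  obtain ⟨u, rfl, hu⟩ : ∃ u, k = some u ∧
      ∃ w l, (toTrace (α ++ β ++ γ)).Done u (Request.write y w) (Reply.ok l) := by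
    rw [PartialReplication.write_mem_ops] at hwk
    obtain rfl | ⟨u, w, l, rfl, hd⟩ := hwk
    · exfalso
      obtain h | h := hkb
      · cases h
      · exact hinit _ hex b y (hhA.mem_of_lt _ _ h).1 h
    · exact ⟨u, rfl, w, l, hd⟩
  have hua : u ≠ a := by
    rintro rfl
    obtain ⟨w, l, m, n, ⟨p', hm⟩, -⟩ := hu
    exact hnw _ _ _ ⟨m, hm⟩
  obtain ⟨d, hd⟩ := hex
  have hB := h₁.transfer h₂ (hα.clientEquiv_append_comm hβ) hd
  have hBe := (hα.clientEquiv_append_comm hβ).append γ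
  have hdone : (toTrace (β ++ α ++ γ)).Done a (Request.read y) (Reply.ok (some u)) := by
    obtain ⟨u', he, hd'⟩ := read_mem_ops.1 (hoA ▸ hk)
    cases he
    exact (hBe.done _ _ _).1 hd'
  have hnodone : ∀ r l, (toTrace (β ++ α)).Done a r l → r = Request.read x ∧ l = Reply.ok none := by
    intro r l h
    obtain ⟨p', j, hj, rfl⟩ := (hβα.done _ _ _).1 h
    simp [hab, hat] at hj
    exact ⟨hj.2.1, by rw [hj.2.2]⟩
  have hsplit : ∀ i r l, (toTrace (β ++ α ++ γ)).Done i r l →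
      (toTrace (β ++ α)).Done i r l ∨ (toTrace γ).Done i r l := by
    intro i r l h
    obtain h | h | ⟨h, -⟩ := done_append.1 h
    · exact Or.inl h
    · exact Or.inr h
    · exact (hβα.pending _ _ h).elim
  obtain ⟨m, n, hmn⟩ : (toTrace γ).Done a (Request.read y) (Reply.ok (some u)) := by
    obtain h | h := hsplit _ _ _ hdone
    · have := (hnodone _ _ h).1
      simp only [Request.read.injEq] at this
      exact (hxy this.symm).elim
    · exact h
  -- The read of `y` is the only request of `T_a` in `γ`, and it is answered positively; so
  -- afterwards `T_a` is neither waiting nor aborted, and may ask to commit.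
  have hmuniq : ∀ r p' m', (toTrace γ).RequestAt a r p' m' → m' = m := by
    intro r p' m' hm'
    obtain ⟨rfl, -⟩ := hγa r p' ⟨m', hm'⟩
    obtain ⟨q', hq'⟩ := hmn.1
    exact IsExecution.read_unique ⟨d, hB⟩ hm' hq'
  obtain ⟨δ, l, hδex, hδ⟩ := exists_call hOFU hWFQ ⟨d, hB⟩ (i := a) (p := p)
    (r := Request.commit) (allowed_iff.2 ⟨by
      intro p' r' h
      rw [← hBe.requested] at h
      obtain h | h := requested_append.1 h
      · exact (hreqa _ _ h).2
      · exact (hγa _ _ h).2, by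
      intro r' h
      obtain ⟨p', m', hm', hn⟩ | ⟨h, -⟩ := pending_append.1 h
      · obtain rfl := hmuniq _ _ _ hm'
        exact hn n hmn.2.2.1 _ hmn.2.1
      · exact hβα.pending _ _ h, by
      rintro (⟨j, h⟩ | ⟨r, h⟩)
      · obtain h | ⟨m', n', ⟨p', h⟩, -⟩ := hsplit _ _ _ h
        · cases (hnodone _ _ h).1
        · cases (hγa _ _ ⟨m', h⟩).1
      · obtain h | ⟨m', n', h⟩ := hsplit _ _ _ h
        · cases (hnodone _ _ h).2
        · obtain ⟨p', hp'⟩ := h.1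
          obtain rfl := hmuniq _ _ _ hp'
          exact absurd (h.unique hmn).2 nofun, trivial⟩) (by
      rintro j z - (⟨w, p', hw⟩ | ⟨w, hw⟩) -
      · exact (hnw _ _ _ ((hBe.requested _ _ _).2 hw)).elim
      · cases hw)
  -- By ACA, the writer `T_u` has committed before being read. Its commit request is issued and
  -- answered either within the blocks, which leaves `T_b`, or within `γ`; in both cases after the
  -- commit of `T_t` in `β`.
  have hck : (toTrace (β ++ α ++ γ)).RealTime (Operation.commit (some t))
      (Operation.commit (some u)) := by
    have ht := hβ.done_of_mem (i := t) (p := p) (r := .commit) (j := k₃) (by simp)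
    obtain ⟨hhB, hoB, -⟩ := hF _ ⟨d, hB⟩
    have hlt := hACA _ ⟨d, hB⟩ (some a) (some u) y (by simpa using hua.symm)
      (hoB ▸ read_mem_ops.2 ⟨a, rfl, hdone⟩)
    have hcu := (hhB.mem_of_lt _ _ hlt).1
    rw [hoB, commit_mem_ops] at hcu
    obtain hcu | ⟨u', j, he, hcu⟩ := hcu
    · cases hcu
    cases he
    obtain h | h := hsplit _ _ _ hcu
    · have hut : u = t ∨ u = b := by
        obtain ⟨p', j', hj', -⟩ := (hβα.done _ _ _).1 h
        simp at hj'
        tauto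
      obtain rfl | rfl := hut
      -- `T_t` does not write `y` within the blocks, and cannot do so in `γ` because it has already
      -- committed.
      · exfalso
        obtain ⟨w, l, hw⟩ := hu
        obtain hw | ⟨m', n', hw⟩ := hsplit _ _ _ ((hBe.done _ _ _).1 hw)
        · obtain ⟨p', j', hj', -⟩ := (hβα.done _ _ _).1 hw
          simp [htb, hxy.symm] at hj'
        · obtain ⟨p', hp'⟩ := hw.1
          have := (IsExecution.allowed ⟨d, hB⟩ hp').2.2.1
          exact this (Trace.terminated_iff.2 (Or.inl ⟨j, h.append_left⟩))
      · exact (ht.realTime_append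
          (hα.done_of_mem (i := u) (p := q) (r := .commit) (j := j₃) (by simp))).append_right
    · exact ht.append_left.realTime_append h
  exact hF.not_implements_SCONSb hδex (a := a) (k := t) (l := some u) (x := x) (y := y) (v := v)
    (j := l) (j₁ := k₂) (j₂ := k₃)
    (hβα.done_of_mem (p := p) (by simp)).append_left.append_left
    hdone.append_left (hδ.done_of_mem (List.mem_singleton.2 rfl)).append_right
    (hβα.done_of_mem (p := p) (by simp)).append_left.append_left
    (hβα.done_of_mem (p := p) (by simp)).append_left.append_left hck.append_right

end Protocol

end PartialReplication

/-! ### Assembly: the two blocks commute. -/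

theorem mainTheorem4 {P Obj Tx Val State Msg : Type*} [Finite P] [Infinite Tx] [Nonempty Val]
    (S : PartialReplication.Protocol P Obj Tx Val State Msg)
    (F : List (PartialReplication.Step P Obj Tx Val State Msg) →
      PartialReplication.History Obj Tx)
    (replicas : Obj → Set P)
    (hdisj : ∃ x y, (replicas x).Nonempty ∧ (replicas y).Nonempty ∧
      Disjoint (replicas x) (replicas y))
    (hF : S.IsRefinement F)
    (hGPR : S.GPR replicas) (hOFU : S.OFU) (hWFQ : S.WFQ)
    (hsafe : S.Implements F PartialReplication.History.WCF ∨
      (S.Implements F PartialReplication.History.ACA ∧ S.PositiveFreshness F)) :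
    ¬ S.Implements F PartialReplication.History.SCONSb := by
  open PartialReplication Protocol in
  obtain ⟨x, y, ⟨p, hp⟩, ⟨q, hq⟩, hxy⟩ := hdisj
  obtain ⟨v⟩ := ‹Nonempty Val›
  let e := Infinite.natEmbedding Tx
  have hab : e 0 ≠ e 1 := e.injective.ne (by decide)
  have hat : e 0 ≠ e 2 := e.injective.ne (by decide)
  have htb : e 2 ≠ e 1 := e.injective.ne (by decide)
  have hne : x ≠ y := by
    rintro rfl
    exact Set.disjoint_left.1 hxy hp hp
  obtain ⟨α, cα, j₁, j₂, j₃, hαr, hαp, hα⟩ := exists_update_block hGPR hOFU hWFQ hq (e 1) v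
  obtain ⟨β, cβ, k₁, k₂, k₃, hβr, hβp, hβ⟩ :=
    exists_read_update_block hF hGPR hOFU hWFQ hp hat v
  have htx : ∀ i r p' r' p'', (toTrace α).Requested i r p' → ¬ (toTrace β).Requested i r' p'' := by
    intro i r p' r' p'' h h'
    obtain ⟨j, hj⟩ := (hα.requested _ _ _).1 h
    obtain ⟨k, hk⟩ := (hβ.requested _ _ _).1 h'
    have hi : i = e 1 := by simp at hj; tauto
    subst hi
    simp [hab.symm, htb.symm] at hk
  obtain ⟨c, hc, hb, hs, hs'⟩ := hαr.append_of_disjoint hβr hαp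
    (fun s hs => Set.disjoint_left.1 hxy (hβp s hs)) hα.pending htx
  obtain ⟨c', hc', hb', ht, ht'⟩ := hβr.append_of_disjoint hαr hβp
    (fun s hs => Set.disjoint_right.1 hxy (hαp s hs)) hβ.pending
    fun i r p' r' p'' h h' => htx _ _ _ _ _ h' h
  -- Replicas of `x` are in the state left by `β`, replicas of `y` in the state left by `α`, all
  -- other processes in their initial state; the messages in transit form the same multiset.
  obtain rfl : c = c' := by
    refine Config.ext' (fun z => ?_) (by rw [hb, hb', add_comm])
    by_cases hzx : z ∈ replicas x
    · rw [ht z hzx, hs' z (Set.disjoint_left.1 hxy hzx)]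
    · rw [ht' z hzx]
      by_cases hzy : z ∈ replicas y
      · rw [hs z hzy]
      · rw [hs' z hzy, hβr.state_eq_init (p := z) fun s hs he => hzx (he ▸ hβp s hs),
          hαr.state_eq_init (p := z) fun s hs he => hzy (he ▸ hαp s hs)]
  obtain hW | ⟨hA, hPF⟩ := hsafe
  · exact not_implements_SCONSb_of_WCF hF hOFU hWFQ hW hne hab hat htb hα hβ hc hc'
  · exact not_implements_SCONSb_of_ACA hF hOFU hWFQ hA hPF hne hab hat htb hα hβ hc hc'
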